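/- A \emph{planning instance} is a tuple $\Pi=(V,I,G,A)$, where $V$ is a finite set of variables, each $v\in V$ with a finite domain $D(v)$; the initial state $I$ is a \emph{state}, i.e. a map that assigns to every $v\in V$ a value in $D(v)$; the goal $G$ is a \emph{partial state}, i.e. such a map defined on a subset of $V$; and $A$ is a finite set of actions $a=(\mathrm{pre}(a)\Rightarrow\mathrm{post}(a))$ with partial states $\mathrm{pre}(a)$ and $\mathrm{post}(a)$. An action $a$ is applicable in a state $s$ if $s$ agrees with $\mathrm{pre}(a)$ wherever the latter is defined; applying it then overwrites $s$ by $\mathrm{post}(a)$ on the variables on which $\mathrm{post}(a)$ is defined. An action that is not applicable leaves the state unchanged. For a sequence $p$ of actions, $s[p]$ denotes the state obtained from $s$ by applying the actions of $p$ in order; a sequence $p$ of actions from $A$ is a \emph{solution plan} for $\Pi$ if $I[p]$ agrees with $G$ wherever $G$ is defined. An instance of $\{L\}$-CaseMod consists of a planning instance $\Pi=(V,I,G,A)$; a case $(\Pi',c)$, where $\Pi'=(V,J,H,A)$ is a planning instance with the same variables, domains and actions and $c=(c_1,\dots,c_l)$ is a solution plan for $\Pi'$; a subset $A'\subseteq A$;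 and an integer $M\ge 0$. The parameter is $M$, the allowed number of glue steps. The question is whether there are a sequence $(g_1,\dots,g_m)$ of actions from $A'$ with $m\le M$ and an index $0\le i\le m$ such that $(g_1,\dots,g_i,c_1,\dots,c_l,g_{i+1},\dots,g_m)$ is a solution plan for $\Pi$ and $I[(g_1,\dots,g_i)]=J$. A parameterized problem $P$ is \emph{fpt-reducible} to a parameterized problem $Q$ if there is a map $(I,k)\mapsto(I',k')$ from instances of $P$ to instances of $Q$ such that $(I,k)$ is a yes-instance of $P$ if and only if $(I',k')$ is a yes-instance of $Q$; $k'\le g(k)$ for a computable function $g$; and $(I',k')$ can be computed in time $O(f(k)\,n^{c})$ for a computable function $f$ and a constant $c$, where $n$ is the size of $I$. The class $\mathrm{W}[2]$ consists of all parameterized problems that are fpt-reducible to weighted CNF satisfiability, the problem of deciding, for a CNF formula $F$ and the parameter $k$, whether $F$ has a satisfying assignment that sets exactly $k$ of its variables to true. A problem is $\mathrm{W}[2]$-complete if it belongs to $\mathrm{W}[2]$ and every problem in $\mathrm{W}[2]$ is fpt-reducible to it. \textbf{Proposition.} $\{L\}$-CaseMod is $\mathrm{W}[2]$-complete. -/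

import Mathlib

namespace PlanReuse

/-! ### A machine model with a step count

Programs of a first-order language on binary trees (LISP data), in the style of the `WHILE` language
with a single program variable. The elementary operations are charged with the size of the tree they
act on, and so no tree larger than the time spent so far can be produced. Up to a polynomial, running
times in this model are those of deterministic multi-tape Turing machines. -/

/-- Binary trees, the data on which programs operate. -/
inductive Data : Type
  | nil : Data
  | cons : Data → Data → Data

namespace Data

/-- The number of nodes, leaves included. In particular it is positive. -/
def size : Data → ℕ
  | nil => 1
  | cons a b => 1 + a.size + b.size

/-- First component; `nil` has the first component `nil`. -/
def fst : Data → Data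
  | nil => nil
  | cons a _ => a

/-- Second component; `nil` has the second component `nil`. -/
def snd : Data → Data
  | nil => nil
  | cons _ b => b

/-- A list of trees as a tree. -/
def ofList : List Data → Data
  | [] => nil
  | a :: l => cons a (ofList l)

/-- A natural number in unary. -/
def ofNat : ℕ → Data
  | 0 => nil
  | m + 1 => cons nil (ofNat m)

/-- An optional tree as a tree. -/
def ofOption : Option Data → Data
  | none => nil
  | some a => cons a nil

end Data

/-- Programs; each one transforms the current tree. -/
inductive Prog : Type
  /-- do nothing -/
  | skip : Prog
  /-- replace the tree by `nil` -/
  | nil : Prog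
  /-- replace the tree by its first component -/
  | fst : Prog
  /-- replace the tree by its second component -/
  | snd : Prog
  /-- run two programs on the same tree and pair the results -/
  | pair : Prog → Prog → Prog
  /-- run the first program, then the second one on its result -/
  | seq : Prog → Prog → Prog
  /-- run the second program if the first one (the test) yields a tree other than `nil`,
  and the third program otherwise -/
  | ite : Prog → Prog → Prog → Prog
  /-- run the second program as long as the first one (the test) yields a tree other than `nil` -/
  | loop : Prog → Prog → Prog

/-- `Runs p x y t`: the program `p`, started on `x`, halts with result `y` after time `t`.
For given `p` and `x` there is at most one such pair `(y, t)`, and none if `p` does not halt on `x`.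
The result of a test is used only for the decision; the tree is kept. -/
inductive Runs : Prog → Data → Data → ℕ → Prop
  | skip (x : Data) : Runs .skip x x (1 + x.size)
  | nil (x : Data) : Runs .nil x .nil (1 + x.size)
  | fst (x : Data) : Runs .fst x x.fst (1 + x.size)
  | snd (x : Data) : Runs .snd x x.snd (1 + x.size)
  | pair {p q : Prog} {x y z : Data} {s t : ℕ} (hp : Runs p x y s) (hq : Runs q x z t) :
      Runs (.pair p q) x (.cons y z) (1 + s + t)
  | seq {p q : Prog} {x y z : Data} {s t : ℕ} (hp : Runs p x y s) (hq : Runs q y z t) :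
      Runs (.seq p q) x z (1 + s + t)
  | ite_true {c p q : Prog} {x b y : Data} {s t : ℕ} (hc : Runs c x b s) (hb : b ≠ .nil)
      (hp : Runs p x y t) : Runs (.ite c p q) x y (1 + s + t)
  | ite_false {c p q : Prog} {x y : Data} {s t : ℕ} (hc : Runs c x .nil s)
      (hq : Runs q x y t) : Runs (.ite c p q) x y (1 + s + t)
  | loop_stop {c p : Prog} {x : Data} {s : ℕ} (hc : Runs c x .nil s) :
      Runs (.loop c p) x x (1 + s + x.size)
  | loop_step {c p : Prog} {x b y z : Data} {s t u : ℕ} (hc : Runs c x b s) (hb : b ≠ .nil)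
      (hp : Runs p x y t) (hl : Runs (.loop c p) y z u) : Runs (.loop c p) x z (1 + s + t + u)

/-! ### Parameterized problems and fpt-reductions -/

/-- A parameterized decision problem. An instance is a pair `(I, k)` of a main part `I : Inst` and a
parameter `k`; the main part is given to a machine as the tree `enc I`. -/
structure ParamProblem where
  /-- the main parts of instances -/
  Inst : Type
  /-- the encoding of main parts -/
  enc : Inst → Data
  enc_injective : Function.Injective enc
  /-- the yes-instances -/
  Yes : Inst → ℕ → Prop

/-- The input that a machine receives for the instance `(I, k)`. -/
def ParamProblem.code (P : ParamProblem) (x : P.Inst × ℕ) : Data :=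
  .cons (P.enc x.1) (.ofNat x.2)

/-- `P` is fpt-reducible to `Q`: there is a map `R` from instances of `P` to instances of `Q` that
preserves the answer, whose new parameter is bounded by a computable function of the old one, and
which some program computes in time at most `f k * n ^ e`, where `f` is computable, `e` is constant,
and `n` is the size of the main part of the instance. -/
def FptReducible (P Q : ParamProblem) : Prop :=
  ∃ (R : P.Inst × ℕ → Q.Inst × ℕ) (p : Prog) (f g : ℕ → ℕ) (e : ℕ),
    Computable f ∧ Computable g ∧
    (∀ I k, P.Yes I k ↔ Q.Yes (R (I, k)).1 (R (I, k)).2) ∧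
    (∀ I k, (R (I, k)).2 ≤ g k) ∧
    (∀ I k, ∃ t ≤ f k * (P.enc I).size ^ e, Runs p (P.code (I, k)) (Q.code (R (I, k))) t)

/-! ### Weighted satisfiability of CNF formulas, and the class W[2] -/

/-- A literal: a variable, with `true` for the positive and `false` for the negative literal. -/
abbrev Literal := ℕ × Bool

/-- A clause: the disjunction of its literals. -/
abbrev Clause := List Literal

/-- A formula in conjunctive normal form: the conjunction of its clauses. -/
abbrev CNF := List Clause

/-- The set of the variables that occur in a formula. -/
def CNF.vars (F : CNF) : Finset ℕ :=
  (F.flatten.map Prod.fst).toFinset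

/-- `F` is true under the assignment that makes exactly the variables in `S` true. -/
def CNF.SatisfiedBy (F : CNF) (S : Finset ℕ) : Prop :=
  ∀ C ∈ F, ∃ l ∈ C, (l.1 ∈ S ↔ l.2 = true)

/-- Encoding of a truth value. -/
def encBool (b : Bool) : Data :=
  .ofNat b.toNat

/-- Encoding of a literal. -/
def encLiteral (l : Literal) : Data :=
  .cons (.ofNat l.1) (encBool l.2)

/-- Encoding of a clause. -/
def encClause (C : Clause) : Data :=
  .ofList (C.map encLiteral)

/-- Encoding of a formula. -/
def encCNF (F : CNF) : Data :=
  .ofList (F.map encClause)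

theorem Data.ofNat_injective : Function.Injective Data.ofNat := by
  intro a
  induction a with
  | zero => intro b h; cases b <;> simp_all [Data.ofNat]
  | succ a ih =>
    intro b h
    cases b with
    | zero => simp [Data.ofNat] at h
    | succ b => simp only [Data.ofNat, Data.cons.injEq, true_and] at h; rw [ih h]

theorem Data.ofList_injective : Function.Injective Data.ofList := by
  intro a
  induction a with
  | nil => intro b h; cases b <;> simp_all [Data.ofList]
  | cons a l ih =>
    intro b h
    cases b with
    | nil => simp [Data.ofList] at h
    | cons b m =>
      simp only [Data.ofList, Data.cons.injEq] at h
      rw [h.1, ih h.2]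

theorem Data.ofOption_injective : Function.Injective Data.ofOption := by
  intro a b h
  cases a <;> cases b <;> simp_all [Data.ofOption]

theorem encBool_injective : Function.Injective encBool := by
  intro a b h
  have := Data.ofNat_injective h
  cases a <;> cases b <;> simp_all

theorem encLiteral_injective : Function.Injective encLiteral := by
  rintro ⟨a, s⟩ ⟨b, t⟩ h
  simp only [encLiteral, Data.cons.injEq] at h
  rw [Data.ofNat_injective h.1, encBool_injective h.2]

theorem encClause_injective : Function.Injective encClause :=
  Data.ofList_injective.comp encLiteral_injective.list_map

theorem encCNF_injective : Function.Injective encCNF :=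
  Data.ofList_injective.comp encClause_injective.list_map

/-- Weighted CNF satisfiability: given a CNF formula `F` and the parameter `k`, does `F` have a
satisfying assignment that sets exactly `k` of its variables to true? -/
def weightedCNFSat : ParamProblem where
  Inst := CNF
  enc := encCNF
  enc_injective := encCNF_injective
  Yes F k := ∃ S : Finset ℕ, S ⊆ F.vars ∧ S.card = k ∧ F.SatisfiedBy S

/-- The class W[2]: the parameterized problems that are fpt-reducible to weighted CNF
satisfiability. -/
def W2 : Set ParamProblem :=
  {P | FptReducible P weightedCNFSat}

/-- A problem is W[2]-hard if every problem in W[2] is fpt-reducible to it. -/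
def W2Hard (P : ParamProblem) : Prop :=
  ∀ Q ∈ W2, FptReducible Q P

/-- A problem is W[2]-complete if it belongs to W[2] and is W[2]-hard. -/
def W2Complete (P : ParamProblem) : Prop :=
  P ∈ W2 ∧ W2Hard P

/-! ### SAS+ planning -/

/-- Finitely many variables, each with a finite domain. Variables are numbered from `0`, and so are
the values of each variable. -/
structure VarSystem where
  /-- the number of variables -/
  num : ℕ
  /-- the number of elements of the domain of a variable -/
  dom : Fin num → ℕ

/-- A state assigns to each variable a value in its domain. -/
abbrev State (X : VarSystem) := (v : Fin X.num) → Fin (X.dom v)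

/-- A partial state assigns values in their domains to some of the variables. -/
abbrev PartialState (X : VarSystem) := (v : Fin X.num) → Option (Fin (X.dom v))

/-- The state `s` agrees with the partial state `p` wherever `p` is defined. -/
abbrev State.Satisfies {X : VarSystem} (s : State X) (p : PartialState X) : Prop :=
  ∀ v, ∀ x, p v = some x → s v = x

/-- An action: a precondition and a postcondition. -/
@[ext] structure Act (X : VarSystem) where
  pre : PartialState X
  post : PartialState X

/-- The effect of a single action: an action that is not applicable does not change the state. -/
def State.apply {X : VarSystem} (s : State X) (a : Act X) : State X :=
  if State.Satisfies s a.pre then fun v => (a.post v).getD (s v) else s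

/-- The state `s[p]` that results from applying the plan `p` to the state `s`. -/
def State.run {X : VarSystem} (s : State X) (p : List (Act X)) : State X :=
  p.foldl State.apply s

/-- A planning instance over given variables and domains. -/
structure PlanningInstance (X : VarSystem) where
  /-- the initial state -/
  init : State X
  /-- the goal -/
  goal : PartialState X
  /-- the set of actions, as the set of the members of a list -/
  acts : List (Act X)

/-- `p` is a solution plan: a sequence of actions of the instance that leads from the initial state
to a goal state. -/
def PlanningInstance.IsSolution {X : VarSystem} (Pl : PlanningInstance X) (p : List (Act X)) : Prop :=
  (∀ a ∈ p, a ∈ Pl.acts) ∧ State.Satisfies (State.run Pl.init p) Pl.goal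

/-! ### Case modification -/

/-- An instance of the case modification problem, without the bound on the number of glue steps. -/
structure CaseModInstance where
  /-- the variables and domains, common to the two planning instances -/
  X : VarSystem
  /-- the planning instance to be solved -/
  target : PlanningInstance X
  /-- the planning instance of the stored case -/
  stored : PlanningInstance X
  acts_eq : stored.acts = target.acts
  /-- the plan of the stored case -/
  plan : List (Act X)
  plan_isSolution : stored.IsSolution plan
  /-- the set of actions that may serve as glue steps, as the set of the members of a list -/
  glueActs : List (Act X)
  glueActs_subset : ∀ a ∈ glueActs, a ∈ target.acts

/-- The stored plan can be turned into a solution plan of the target by at most `M` glue steps: some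
of them precede the stored plan and lead exactly to the initial state of the stored case, the others
follow it. -/
def CaseModInstance.Solvable (C : CaseModInstance) (M : ℕ) : Prop :=
  ∃ g : List (Act C.X), (∀ a ∈ g, a ∈ C.glueActs) ∧ g.length ≤ M ∧
    ∃ i ≤ g.length, C.target.IsSolution (g.take i ++ C.plan ++ g.drop i) ∧
      State.run C.target.init (g.take i) = C.stored.init

/-- Encoding of a system of variables: the list of the domain sizes. -/
def encVarSystem (X : VarSystem) : Data :=
  .ofList (List.ofFn fun v => .ofNat (X.dom v))

/-- Encoding of a state: the list of its values. -/
def encState {X : VarSystem} (s : State X) : Data :=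
  .ofList (List.ofFn fun v => .ofNat (s v))

/-- Encoding of a partial state: the list of its optional values. -/
def encPartialState {X : VarSystem} (p : PartialState X) : Data :=
  .ofList (List.ofFn fun v => .ofOption ((p v).map fun x : Fin (X.dom v) => Data.ofNat x.val))

/-- Encoding of an action. -/
def encAct {X : VarSystem} (a : Act X) : Data :=
  .cons (encPartialState a.pre) (encPartialState a.post)

/-- Encoding of a list of actions. -/
def encActs {X : VarSystem} (l : List (Act X)) : Data :=
  .ofList (l.map encAct)

/-- Encoding of an instance of case modification. The set of actions, which is common to the two
planning instances, is written down once. -/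
def encCaseMod (C : CaseModInstance) : Data :=
  .ofList [encVarSystem C.X, encState C.target.init, encPartialState C.target.goal,
    encActs C.target.acts, encState C.stored.init, encPartialState C.stored.goal,
    encActs C.plan, encActs C.glueActs]

theorem encVarSystem_injective : Function.Injective encVarSystem := by
  rintro ⟨n, d⟩ ⟨m, e⟩ h
  have h1 := Data.ofList_injective h
  have hn : n = m := by simpa using congrArg List.length h1
  subst hn
  have h2 := List.ofFn_injective h1
  congr 1
  funext v
  exact Data.ofNat_injective (congrFun h2 v)

theorem encState_injective {X : VarSystem} : Function.Injective (encState (X := X)) := by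
  intro s t h
  have h2 := List.ofFn_injective (Data.ofList_injective h)
  funext v
  exact Fin.ext (Data.ofNat_injective (congrFun h2 v))

theorem encPartialState_injective {X : VarSystem} :
    Function.Injective (encPartialState (X := X)) := by
  intro s t h
  have h2 := List.ofFn_injective (Data.ofList_injective h)
  funext v
  exact Option.map_injective (fun a b hab => Fin.ext (Data.ofNat_injective hab))
    (Data.ofOption_injective (congrFun h2 v))

theorem encAct_injective {X : VarSystem} : Function.Injective (encAct (X := X)) := by
  intro a b h
  simp only [encAct, Data.cons.injEq] at h
  exact Act.ext (encPartialState_injective h.1) (encPartialState_injective h.2)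

theorem encActs_injective {X : VarSystem} : Function.Injective (encActs (X := X)) :=
  Data.ofList_injective.comp encAct_injective.list_map

theorem encCaseMod_injective : Function.Injective encCaseMod := by
  rintro ⟨X, ⟨I, G, A⟩, ⟨J, H, B⟩, hB, c, hc, A', hA'⟩
    ⟨Y, ⟨I₂, G₂, A₂⟩, ⟨J₂, H₂, B₂⟩, hB₂, c₂, hc₂, A₂', hA₂'⟩ h
  have h1 := Data.ofList_injective h
  simp only [List.cons.injEq, and_true] at h1
  obtain ⟨hX, hI, hG, hA, hJ, hH, hp, hg⟩ := h1
  obtain rfl := encVarSystem_injective hX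
  obtain rfl := encState_injective hI
  obtain rfl := encPartialState_injective hG
  obtain rfl := encActs_injective hA
  obtain rfl := encState_injective hJ
  obtain rfl := encPartialState_injective hH
  obtain rfl := encActs_injective hp
  obtain rfl := encActs_injective hg
  obtain rfl : B = A := hB
  obtain rfl : B₂ = B := hB₂
  rfl

/-- `{L}`-CaseMod: case modification, parameterized by the allowed number of glue steps. -/
def lCaseMod : ParamProblem where
  Inst := CaseModInstance
  enc := encCaseMod
  enc_injective := encCaseMod_injective
  Yes C M := C.Solvable M

end PlanReuse

namespace PlanReuse

/-! Membership. An inapplicable action does nothing, so an idle action may stand in for it. On the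
state `J` the stored plan acts like one action that requires `J` and sets the state it leads to. A
solution with at most `M` glue steps is therefore a timeline of `M + 3` slots: one slot sets the
initial state, `M + 1` slots each hold a glue action, the idle action or the plan (used at least
once), and one slot tests the goal (`solvable_iff_timeline`). Using the plan again is harmless:
every use starts in `J` and ends in the same state, so all that happens between the first and the
last use can be cut out (`glue_of_timeline`).

Timelines are CNF models because applicability can be expressed without naming intermediate states.
A required value is present exactly if, whenever an earlier slot sets a different value, a slot
strictly in between sets the right one. This gives clauses with two negative literals, for the
choices in the two slots, and positive literals for the possible repairs. Each slot needs a true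
variable, and weight `M + 3` leaves room for only one per slot (`timelineCNF_iff`).

Hardness. With an empty stored plan and `J = I`, the question is whether a plan of length at most `k
+ 1` exists. The plan walks upwards through the variables of the formula, jumping from one selected
variable to the next and finally to a position behind all of them. A jump marks the clauses that its
end satisfies positively or a skipped variable satisfies negatively. A counter allows exactly `k +
1` effective jumps, and the goal asks for all marks (`selectionInstance_solvable_iff`). Soundness is
the invariant `Selected`; completeness is `exists_plan`.

Both maps run in polynomial time with the parameter in unary and change it to `M + 3` and `k + 1`,
so `FptReducible.of_runs` applies; hardness for all of W[2] follows by `FptReducible.trans`. The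
programs come from closure properties of `PolyTime`, above all bounded folds (`PolyTime.foldl`). -/

theorem Data.size_pos (x : Data) : 0 < x.size := by
  cases x <;> simp only [Data.size] <;> omega

theorem Data.size_fst_le (x : Data) : x.fst.size ≤ x.size := by
  cases x <;> simp [Data.size, Data.fst]; omega

theorem Data.size_snd_le (x : Data) : x.snd.size ≤ x.size := by
  cases x <;> simp [Data.size, Data.snd]

theorem Data.size_ofNat (n : ℕ) : (Data.ofNat n).size = 2 * n + 1 := by
  induction n with
  | zero => rfl
  | succ n ih => simp only [Data.ofNat, Data.size, ih]; omega

/-- No tree larger than the running time can be produced. -/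
theorem Runs.size_le {p : Prog} {x y : Data} {t : ℕ} (h : Runs p x y t) : y.size ≤ t := by
  induction h with
  | skip x => omega
  | nil x => simp [Data.size]
  | fst x => have := x.size_fst_le; omega
  | snd x => have := x.size_snd_le; omega
  | pair _ _ h1 h2 => simp only [Data.size]; omega
  | seq _ _ _ h2 => omega
  | ite_true _ _ _ _ h2 => omega
  | ite_false _ _ _ h2 => omega
  | loop_stop _ _ => omega
  | loop_step _ _ _ _ _ _ h2 => omega

/-! ### Monotonicity and growth of polynomials with natural coefficients. -/

theorem eval_le_eval (P : Polynomial ℕ) {m n : ℕ} (h : m ≤ n) : P.eval m ≤ P.eval n := by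
  simp only [Polynomial.eval_eq_sum, Polynomial.sum]
  exact Finset.sum_le_sum fun i _ => Nat.mul_le_mul_left _ (Nat.pow_le_pow_left h i)

theorem eval_le_mul_pow (P : Polynomial ℕ) {n : ℕ} (h : 0 < n) :
    P.eval n ≤ P.eval 1 * n ^ P.natDegree := by
  simp only [Polynomial.eval_eq_sum, Polynomial.sum, Finset.sum_mul, one_pow, mul_one]
  exact Finset.sum_le_sum fun i hi =>
    Nat.mul_le_mul_left _ (Nat.pow_le_pow_right h (Polynomial.le_natDegree_of_mem_supp i hi))

/-! ### Polynomial-time functions between encoded types -/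

/-- Types whose elements can be given to a machine. -/
class DataEnc (α : Type) where
  /-- the tree that represents an element -/
  enc : α → Data

open DataEnc

instance : DataEnc Unit := ⟨fun _ => .nil⟩
instance : DataEnc ℕ := ⟨Data.ofNat⟩
instance : DataEnc Bool := ⟨encBool⟩
instance {α β : Type} [DataEnc α] [DataEnc β] : DataEnc (α × β) := ⟨fun p => .cons (enc p.1) (enc p.2)⟩
instance {α : Type} [DataEnc α] : DataEnc (List α) := ⟨fun l => .ofList (l.map enc)⟩
instance {α : Type} [DataEnc α] : DataEnc (Option α) := ⟨fun o => .ofOption (o.map enc)⟩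

section
variable {α β γ : Type} [DataEnc α] [DataEnc β] [DataEnc γ]

/-- The size of the encoding. -/
def sz (a : α) : ℕ := (enc a).size

/-- `f` is computed by a program in polynomial time. -/
def PolyTime (f : α → β) : Prop :=
  ∃ (p : Prog) (P : Polynomial ℕ), ∀ a, ∃ t ≤ P.eval (sz a), Runs p (enc a) (enc (f a)) t

theorem sz_pos (a : α) : 0 < sz a := Data.size_pos _

theorem sz_pair (a : α) (b : β) : sz (a, b) = 1 + sz a + sz b := rfl

theorem sz_nat (n : ℕ) : sz n = 2 * n + 1 := Data.size_ofNat n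

theorem sz_nil : sz ([] : List α) = 1 := rfl

theorem sz_cons (a : α) (l : List α) : sz (a :: l) = 1 + sz a + sz l := rfl

theorem sz_append (l m : List α) : sz (l ++ m) + 1 = sz l + sz m := by
  induction l with
  | nil => simp [sz_nil]; omega
  | cons a l ih => simp only [List.cons_append, sz_cons]; omega

theorem sz_le_of_mem {a : α} {l : List α} (h : a ∈ l) : sz a ≤ sz l := by
  induction l with
  | nil => simp at h
  | cons b l ih =>
    rw [sz_cons]
    rcases List.mem_cons.1 h with rfl | h
    · omega
    · have := ih h; omega

theorem length_le_sz (l : List α) : l.length ≤ sz l := by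
  induction l with
  | nil => simp
  | cons b l ih => rw [sz_cons, List.length_cons]; omega

theorem sz_le_of_forall {l : List α} {K : ℕ} (h : ∀ a ∈ l, sz a ≤ K) :
    sz l ≤ 1 + l.length * (1 + K) := by
  induction l with
  | nil => simp [sz_nil]
  | cons b l ih =>
    have h1 := h b (by simp)
    have h2 := ih fun a ha => h a (by simp [ha])
    rw [sz_cons, List.length_cons, Nat.succ_mul]
    omega

theorem PolyTime.sz_le {f : α → β} (h : PolyTime f) :
    ∃ P : Polynomial ℕ, ∀ a, sz (f a) ≤ P.eval (sz a) := by
  obtain ⟨p, P, h⟩ := h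
  refine ⟨P, fun a => ?_⟩
  obtain ⟨t, ht, hr⟩ := h a
  exact hr.size_le.trans ht

/-- A program sees only trees, so values of different types with the same tree are interchangeable.
This makes `cons`, `some`, successor and the passage between instances and lists available from
pairs and projections. -/
theorem PolyTime.of_enc_eq {f : α → β} {g : α → γ} (hg : PolyTime g)
    (h : ∀ a, enc (f a) = enc (g a)) : PolyTime f := by
  obtain ⟨p, P, hp⟩ := hg
  exact ⟨p, P, fun a => by rw [h]; exact hp a⟩

theorem PolyTime.of_eq {f g : α → β} (hg : PolyTime g) (h : ∀ a, f a = g a) : PolyTime f :=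
  hg.of_enc_eq fun a => by rw [h]

theorem PolyTime.id : PolyTime fun a : α => a :=
  ⟨.skip, 1 + Polynomial.X, fun a => ⟨_, by simp [sz], .skip _⟩⟩

theorem PolyTime.const (b : β) : PolyTime fun _ : α => b := by
  suffices h : ∀ d : Data, ∃ (p : Prog) (P : Polynomial ℕ), ∀ a : α, ∃ t ≤ P.eval (sz a),
      Runs p (enc a) d t from h (enc b)
  intro d
  induction d with
  | nil => exact ⟨.nil, 1 + Polynomial.X, fun a => ⟨_, by simp [sz], .nil _⟩⟩
  | cons d e hd he =>
    obtain ⟨p, P, hp⟩ := hd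
    obtain ⟨q, Q, hq⟩ := he
    refine ⟨.pair p q, 1 + P + Q, fun a => ?_⟩
    obtain ⟨s, hs, hp⟩ := hp a
    obtain ⟨t, ht, hq⟩ := hq a
    exact ⟨_, by simp; omega, .pair hp hq⟩

/-- The intermediate result is no larger than the time spent on it (`Runs.size_le`), so the second
time bound can be evaluated at the first. -/
theorem PolyTime.comp {g : β → γ} {f : α → β} (hg : PolyTime g) (hf : PolyTime f) :
    PolyTime fun a => g (f a) := by
  obtain ⟨p, P, hp⟩ := hf
  obtain ⟨q, Q, hq⟩ := hg
  refine ⟨.seq p q, 1 + P + Q.comp P, fun a => ?_⟩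
  obtain ⟨s, hs, hp⟩ := hp a
  obtain ⟨t, ht, hq⟩ := hq (f a)
  refine ⟨_, ?_, .seq hp hq⟩
  have := eval_le_eval Q (hp.size_le.trans hs)
  simp only [Polynomial.eval_add, Polynomial.eval_one, Polynomial.eval_comp]
  exact add_le_add (by omega) (ht.trans this)

theorem PolyTime.pair {f : α → β} {g : α → γ} (hf : PolyTime f) (hg : PolyTime g) :
    PolyTime fun a => (f a, g a) := by
  obtain ⟨p, P, hp⟩ := hf
  obtain ⟨q, Q, hq⟩ := hg
  refine ⟨.pair p q, 1 + P + Q, fun a => ?_⟩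
  obtain ⟨s, hs, hp⟩ := hp a
  obtain ⟨t, ht, hq⟩ := hq a
  exact ⟨_, by simp; omega, .pair hp hq⟩

theorem PolyTime.fst {f : α → β × γ} (hf : PolyTime f) : PolyTime fun a => (f a).1 :=
  PolyTime.comp (g := fun q : β × γ => q.1)
    ⟨.fst, 1 + Polynomial.X, fun a => ⟨_, by simp [sz], .fst _⟩⟩ hf

theorem PolyTime.snd {f : α → β × γ} (hf : PolyTime f) : PolyTime fun a => (f a).2 :=
  PolyTime.comp (g := fun q : β × γ => q.2)
    ⟨.snd, 1 + Polynomial.X, fun a => ⟨_, by simp [sz], .snd _⟩⟩ hf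

theorem enc_bool_ne {b : Bool} : enc b ≠ .nil ↔ b = true := by
  cases b <;> simp [enc, encBool, Data.ofNat]

theorem PolyTime.ite {c : α → Bool} {f g : α → β} (hc : PolyTime c) (hf : PolyTime f)
    (hg : PolyTime g) : PolyTime fun a => if c a = true then f a else g a := by
  obtain ⟨r, R, hr⟩ := hc
  obtain ⟨p, P, hp⟩ := hf
  obtain ⟨q, Q, hq⟩ := hg
  refine ⟨.ite r p q, 1 + R + P + Q, fun a => ?_⟩
  obtain ⟨u, hu, hr⟩ := hr a
  obtain ⟨s, hs, hp⟩ := hp a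
  obtain ⟨t, ht, hq⟩ := hq a
  simp only [Polynomial.eval_add, Polynomial.eval_one]
  cases h : c a with
  | true => exact ⟨1 + u + s, by omega, .ite_true hr (enc_bool_ne.2 h) (by simpa using hp)⟩
  | false =>
    rw [h] at hr
    exact ⟨1 + u + t, by omega, .ite_false hr (by simpa using hq)⟩

/-- Comparison with `nil` is the only test of the machine; emptiness of lists and the order of
numbers are reduced to it. -/
theorem PolyTime.decide_nil {f : α → β} (hf : PolyTime f) {b : α → Bool}
    (h : ∀ a, b a = true ↔ enc (f a) = .nil) : PolyTime b := by
  obtain ⟨p, P, hp⟩ := hf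
  obtain ⟨q, Q, hq⟩ := PolyTime.const (α := α) true
  obtain ⟨r, R, hr⟩ := PolyTime.const (α := α) false
  refine ⟨.ite p r q, 1 + P + R + Q, fun a => ?_⟩
  obtain ⟨s, hs, hp⟩ := hp a
  obtain ⟨t, ht, hq⟩ := hq a
  obtain ⟨u, hu, hr⟩ := hr a
  simp only [Polynomial.eval_add, Polynomial.eval_one]
  by_cases hn : enc (f a) = .nil
  · rw [hn] at hp
    rw [(h a).2 hn]
    exact ⟨_, by omega, .ite_false hp hq⟩
  · have : b a = false := by
      rw [← Bool.not_eq_true, h]; exact hn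
    rw [this]
    exact ⟨_, by omega, .ite_true hp hn hr⟩

theorem PolyTime.optionElim {o : γ → Option α} {d : γ → β} {f : γ → α → β} (ho : PolyTime o)
    (hd : PolyTime d) (hf : PolyTime fun q : γ × α => f q.1 q.2) :
    PolyTime fun x => (o x).elim (d x) (f x) := by
  obtain ⟨p, P, hp⟩ := ho
  obtain ⟨q, Q, hq⟩ := hd
  obtain ⟨r, R, hr⟩ := hf
  -- The result of a test is discarded, so `p` runs a second time to recover the value. The
  -- polynomial `4 + X + 2 * P` bounds the time needed to build the pair, and hence also the size of
  -- the input of `r`.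
  refine ⟨.ite p (.seq (.pair .skip (.seq p .fst)) r) q,
    1 + P + Q + ((4 + Polynomial.X + 2 * P) + R.comp (4 + Polynomial.X + 2 * P) + 1), fun x => ?_⟩
  obtain ⟨s, hs, hp⟩ := hp x
  obtain ⟨t, ht, hq⟩ := hq x
  simp only [Polynomial.eval_add, Polynomial.eval_one, Polynomial.eval_comp, Polynomial.eval_X,
    Polynomial.eval_mul, Polynomial.eval_ofNat]
  cases h : o x with
  | none =>
    rw [h] at hp
    exact ⟨_, by omega, .ite_false hp hq⟩
  | some a =>
    obtain ⟨u, hu, hr⟩ := hr (x, a)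
    rw [h] at hp
    have h1 : Runs (.pair .skip (.seq p .fst)) (enc x) (enc (x, a)) _ :=
      .pair (.skip _) (.seq hp (.fst _))
    have h2 := h1.size_le
    have h4 := hp.size_le
    have h3 := eval_le_eval R (m := sz (x, a)) (n := 4 + sz x + 2 * P.eval (sz x))
      (by simp only [sz] at *; omega)
    refine ⟨_, ?_, .ite_true hp (by simp [enc, Data.ofOption]) (.seq h1 hr)⟩
    simp only [sz] at *
    omega

/-! ### Lists -/

theorem PolyTime.cons {f : γ → α} {l : γ → List α} (hf : PolyTime f) (hl : PolyTime l) :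
    PolyTime fun x => f x :: l x :=
  (hf.pair hl).of_enc_eq fun _ => rfl

theorem PolyTime.some {f : γ → α} (hf : PolyTime f) : PolyTime fun x => some (f x) :=
  (hf.pair (PolyTime.const ())).of_enc_eq fun _ => rfl

theorem PolyTime.tail {l : γ → List α} (hl : PolyTime l) : PolyTime fun x => (l x).tail := by
  refine PolyTime.comp (g := fun l : List α => l.tail)
    ⟨.snd, 1 + Polynomial.X, fun a => ⟨1 + sz a, ?_, ?_⟩⟩ hl
  · simp
  · cases a <;> exact .snd _

theorem PolyTime.isEmpty {l : γ → List α} (hl : PolyTime l) : PolyTime fun x => (l x).isEmpty :=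
  hl.decide_nil fun a => by cases l a <;> simp [enc, Data.ofList]

theorem PolyTime.head? {l : γ → List α} (hl : PolyTime l) : PolyTime fun x => (l x).head? := by
  refine PolyTime.comp (g := fun l : List α => l.head?)
    ⟨.ite .skip (.pair .fst .nil) .nil, 5 + 3 * Polynomial.X, fun a => ?_⟩ hl
  simp only [Polynomial.eval_add, Polynomial.eval_X,
    Polynomial.eval_mul, Polynomial.eval_ofNat]
  cases a with
  | nil => exact ⟨_, by simp only [sz]; omega, .ite_false (.skip _) (.nil _)⟩
  | cons a l =>
    exact ⟨_, by simp only [sz]; omega,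
      .ite_true (.skip _) (by simp [enc, Data.ofList]) (.pair (.fst _) (.nil _))⟩

/-- Iterating a polynomial-time step may blow up exponentially. If every intermediate accumulator is
polynomially bounded, each round is polynomial and the number of rounds is at most the size of the
list. -/
theorem PolyTime.foldl {l : γ → List α} {init : γ → β} {step : γ → β → α → β} (hl : PolyTime l)
    (hi : PolyTime init) (hs : PolyTime fun q : γ × β × α => step q.1 q.2.1 q.2.2)
    (Q : Polynomial ℕ)
    (hQ : ∀ x l₁ l₂, l x = l₁ ++ l₂ → sz (l₁.foldl (step x) (init x)) ≤ Q.eval (sz x)) :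
    PolyTime fun x => (l x).foldl (step x) (init x) := by
  obtain ⟨p, P, hp⟩ := hs
  -- The loop works on the triple of remaining list, parameter `x` and accumulator; its test `.fst`
  -- is `nil` exactly when the list is used up.
  set body : Prog := .pair (.seq .fst .snd) (.pair (.seq .snd .fst)
    (.seq (.pair (.seq .snd .fst) (.pair (.seq .snd .snd) (.seq .fst .fst))) p)) with hbody
  -- `K` bounds every triple met by the loop; the constants `100` generously absorb the bookkeeping
  -- of a round.
  have key : ∀ (x : γ) (K : ℕ) (m : List α) (b : β),
      (∀ m₁ m₂, m = m₁ ++ m₂ → sz (m₂, x, m₁.foldl (step x) b) ≤ K) →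
      ∃ t ≤ (m.length + 1) * (100 + 100 * K + P.eval K),
        Runs (.loop .fst body) (enc (m, x, b)) (enc (([] : List α), x, m.foldl (step x) b)) t := by
    intro x K m
    induction m with
    | nil =>
      intro b hK
      have h0 := hK [] [] rfl
      refine ⟨_, ?_, Runs.loop_stop (.fst _)⟩
      simp only [sz, List.foldl_nil] at h0 ⊢
      simp only [List.length_nil]
      omega
    | cons a m ih =>
      intro b hK
      obtain ⟨u, hu, hr⟩ := ih (step x b a) fun m₁ m₂ h => hK (a :: m₁) m₂ (by simp [h])
      have h0 : sz (a :: m, x, b) ≤ K := hK [] (a :: m) rfl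
      obtain ⟨t, ht, hpr⟩ := hp (x, b, a)
      have hb : Runs body (enc (a :: m, x, b)) (enc (m, x, step x b a)) _ :=
        .pair (.seq (.fst _) (.snd _)) (.pair (.seq (.snd _) (.fst _))
          (.seq (.pair (.seq (.snd _) (.fst _)) (.pair (.seq (.snd _) (.snd _))
            (.seq (.fst _) (.fst _)))) hpr))
      refine ⟨_, ?_, .loop_step (.fst _) ?_ hb hr⟩
      · have h1 : t ≤ P.eval K := ht.trans (eval_le_eval P (by
          simp only [sz_pair, sz_cons] at *; omega))
        have e1 : (enc (a :: m, x, b)).size = sz (a :: m, x, b) := rfl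
        have e2 : (enc (a :: m, x, b)).fst.size = sz (a :: m) := rfl
        have e3 : (enc (a :: m, x, b)).snd.size = sz (x, b) := rfl
        rw [List.length_cons, Nat.succ_mul]
        simp only [e1, e2, e3]
        simp only [sz_pair, sz_cons] at *
        omega
      · simp [enc, Data.fst, Data.ofList]
  obtain ⟨q, L, hq⟩ := hl.pair (PolyTime.id.pair hi)
  obtain ⟨L₂, hL₂⟩ := hl.sz_le
  set K : Polynomial ℕ := 2 + L₂ + Polynomial.X + Q with hKdef
  refine ⟨.seq q (.seq (.loop .fst body) (.seq .snd .snd)),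
    10 + L + (L₂ + 1) * (100 + 100 * K + P.comp K) + 2 * K + 10, fun x => ?_⟩
  obtain ⟨s, hs, hq⟩ := hq x
  have hKx : K.eval (sz x) = 2 + L₂.eval (sz x) + sz x + Q.eval (sz x) := by
    simp [hKdef]
  have hK : ∀ m₁ m₂, l x = m₁ ++ m₂ →
      sz (m₂, x, m₁.foldl (step x) (init x)) ≤ K.eval (sz x) := by
    intro m₁ m₂ h
    have h1 := hQ x m₁ m₂ h
    have h2 := hL₂ x
    have h3 := sz_append m₁ m₂
    have h4 := sz_pos m₁
    rw [h] at h2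
    rw [hKx]
    simp only [sz_pair]
    omega
  obtain ⟨t, ht, hr⟩ := key x (K.eval (sz x)) (l x) (init x) hK
  refine ⟨_, ?_, .seq hq (.seq hr (.seq (.snd _) (.snd _)))⟩
  have h5 : sz (([] : List α), x, (l x).foldl (step x) (init x)) ≤ K.eval (sz x) :=
    hK (l x) [] (by simp)
  have h6 : (l x).length ≤ L₂.eval (sz x) := (length_le_sz _).trans (hL₂ x)
  have h7 := Nat.mul_le_mul_right (100 + 100 * K.eval (sz x) + P.eval (K.eval (sz x)))
    (Nat.succ_le_succ h6)
  have e1 : (enc (([] : List α), x, (l x).foldl (step x) (init x))).size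
    = sz (([] : List α), x, (l x).foldl (step x) (init x)) := rfl
  have e2 := Data.size_snd_le (enc (([] : List α), x, (l x).foldl (step x) (init x)))
  simp only [Polynomial.eval_add, Polynomial.eval_one, Polynomial.eval_comp,
    Polynomial.eval_mul, Polynomial.eval_ofNat, Nat.succ_eq_add_one] at h7 ⊢
  omega

/-- Folding with a step that increases the size additively. -/
theorem PolyTime.foldl_of_growth {l : γ → List α} {init : γ → β} {step : γ → β → α → β}
    (hl : PolyTime l) (hi : PolyTime init)
    (hs : PolyTime fun q : γ × β × α => step q.1 q.2.1 q.2.2) (Q : Polynomial ℕ)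
    (hQ : ∀ x b a, sz (step x b a) ≤ sz b + Q.eval (sz (x, a))) :
    PolyTime fun x => (l x).foldl (step x) (init x) := by
  obtain ⟨L, hL⟩ := hl.sz_le
  obtain ⟨I, hI⟩ := hi.sz_le
  -- Initial size, plus at most `L` rounds, each adding `Q` at the size of a pair of the parameter
  -- and an entry.
  refine hl.foldl hi hs (I + L * Q.comp (1 + Polynomial.X + L)) fun x l₁ l₂ h => ?_
  simp only [Polynomial.eval_add, Polynomial.eval_one, Polynomial.eval_comp, Polynomial.eval_X,
    Polynomial.eval_mul]
  have hlen : l₁.length ≤ L.eval (sz x) :=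
    (length_le_sz _).trans <| (by have := sz_append l₁ l₂; have := sz_pos l₂; rw [h]; omega :
      sz l₁ ≤ sz (l x)).trans (hL x)
  have hmem : ∀ a ∈ l₁, sz a ≤ L.eval (sz x) := fun a ha =>
    (sz_le_of_mem (by rw [h]; simp [ha])).trans (hL x)
  refine le_trans ?_ (add_le_add (hI x) (Nat.mul_le_mul_right _ hlen))
  clear hlen h
  generalize init x = b
  induction l₁ generalizing b with
  | nil => simp
  | cons a l₁ ih =>
    rw [List.foldl_cons, List.length_cons, Nat.succ_mul]
    have h1 := ih (fun c hc => hmem c (by simp [hc])) (step x b a)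
    have h2 := hQ x b a
    have h3 := eval_le_eval Q (m := sz (x, a)) (n := 1 + sz x + L.eval (sz x)) (by
      have := hmem a (by simp)
      rw [sz_pair]; omega)
    omega

theorem PolyTime.reverse {l : γ → List α} (hl : PolyTime l) : PolyTime fun x => (l x).reverse := by
  refine (PolyTime.foldl_of_growth (step := fun _ b a => a :: b) hl (PolyTime.const [])
    (PolyTime.id.snd.snd.cons PolyTime.id.snd.fst) (1 + Polynomial.X) fun x b a => ?_).of_eq
    fun x => (List.foldl_flip_cons_eq_append' ..).symm ▸ by simp
  simp [sz_cons, sz_pair]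
  omega
end

theorem foldl_replicate_unit {β : Type} (f : β → β) (n : ℕ) (b : β) :
    (List.replicate n ()).foldl (fun b _ => f b) b = f^[n] b := by
  induction n generalizing b with
  | zero => rfl
  | succ n ih => rw [List.replicate_succ, List.foldl_cons, ih]; rfl

section
variable {α β γ : Type} [DataEnc α] [DataEnc β] [DataEnc γ]

theorem PolyTime.map {l : γ → List α} {f : γ → α → β} (hl : PolyTime l)
    (hf : PolyTime fun q : γ × α => f q.1 q.2) : PolyTime fun x => (l x).map (f x) := by
  obtain ⟨P, hP⟩ := hf.sz_le
  refine (PolyTime.foldl_of_growth (step := fun x b a => f x a :: b) hl (PolyTime.const [])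
    ((hf.comp (PolyTime.id.fst.pair PolyTime.id.snd.snd)).cons PolyTime.id.snd.fst) (1 + P)
    fun x b a => ?_).reverse.of_eq fun x => ?_
  · have : sz (f x a) ≤ P.eval (sz (x, a)) := hP (x, a)
    simp [sz_cons]
    omega
  · rw [← List.foldl_map (f := f x) (g := fun b a => a :: b)]
    simp

theorem PolyTime.append {l m : γ → List α} (hl : PolyTime l) (hm : PolyTime m) :
    PolyTime fun x => l x ++ m x := by
  refine (PolyTime.foldl_of_growth (step := fun _ b a => a :: b) hl.reverse hm
    (PolyTime.id.snd.snd.cons PolyTime.id.snd.fst) (1 + Polynomial.X)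
    fun x b a => ?_).of_eq fun x => ?_
  · simp [sz_cons, sz_pair]
    omega
  · simp

theorem PolyTime.flatten {l : γ → List (List α)} (hl : PolyTime l) :
    PolyTime fun x => (l x).flatten := by
  refine (PolyTime.foldl_of_growth (step := fun _ b a => a ++ b) hl.reverse (PolyTime.const [])
    (PolyTime.id.snd.snd.append PolyTime.id.snd.fst) Polynomial.X
    fun x b a => ?_).of_eq fun x => ?_
  · have := sz_append a b
    simp [sz_pair]
    omega
  · simp only [List.foldl_reverse]
    induction l x <;> simp_all

theorem PolyTime.flatMap {l : γ → List α} {f : γ → α → List β} (hl : PolyTime l)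
    (hf : PolyTime fun q : γ × α => f q.1 q.2) : PolyTime fun x => (l x).flatMap (f x) :=
  (hl.map hf).flatten

theorem PolyTime.filter {l : γ → List α} {f : γ → α → Bool} (hl : PolyTime l)
    (hf : PolyTime fun q : γ × α => f q.1 q.2) : PolyTime fun x => (l x).filter (f x) := by
  refine (hl.flatMap (f := fun x a => if f x a = true then [a] else [])
    (hf.ite (PolyTime.id.snd.cons (PolyTime.const [])) (PolyTime.const []))).of_eq fun x => ?_
  induction l x with
  | nil => rfl
  | cons a l ih => rw [List.filter_cons, List.flatMap_cons, ih]; split <;> rfl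

theorem PolyTime.not {b : γ → Bool} (hb : PolyTime b) : PolyTime fun x => !b x :=
  (hb.ite (PolyTime.const false) (PolyTime.const true)).of_eq fun x => by cases b x <;> rfl

theorem PolyTime.and {b c : γ → Bool} (hb : PolyTime b) (hc : PolyTime c) :
    PolyTime fun x => b x && c x :=
  (hb.ite hc (PolyTime.const false)).of_eq fun x => by cases b x <;> simp

theorem PolyTime.any {l : γ → List α} {f : γ → α → Bool} (hl : PolyTime l)
    (hf : PolyTime fun q : γ × α => f q.1 q.2) : PolyTime fun x => (l x).any (f x) := by
  refine (hl.filter hf).isEmpty.not.of_eq fun x => ?_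
  induction l x with
  | nil => rfl
  | cons a l ih => rw [List.filter_cons, List.any_cons, ih]; cases f x a <;> simp

theorem PolyTime.all {l : γ → List α} {f : γ → α → Bool} (hl : PolyTime l)
    (hf : PolyTime fun q : γ × α => f q.1 q.2) : PolyTime fun x => (l x).all (f x) :=
  (hl.any (f := fun x a => !f x a) hf.not).not.of_eq fun x => by
    simp [List.any_eq_not_all_not]

/-! ### Natural numbers -/

/-- A unary number and a list of units are the same tree, which turns counting loops into folds. -/
theorem PolyTime.units {n : γ → ℕ} (hn : PolyTime n) :
    PolyTime fun x => List.replicate (n x) () :=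
  hn.of_enc_eq fun x => by
    show Data.ofList _ = Data.ofNat _
    induction n x with
    | zero => rfl
    | succ n ih => rw [List.replicate_succ, List.map_cons, Data.ofList, ih]; rfl

theorem PolyTime.iterate {n : γ → ℕ} {b : γ → β} {f : γ → β → β} (hn : PolyTime n)
    (hb : PolyTime b) (hf : PolyTime fun q : γ × β => f q.1 q.2) (Q : Polynomial ℕ)
    (hQ : ∀ x b, sz (f x b) ≤ sz b + Q.eval (sz x)) : PolyTime fun x => (f x)^[n x] (b x) :=
  (PolyTime.foldl_of_growth (step := fun x b _ => f x b) hn.units hb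
    (hf.comp (PolyTime.id.fst.pair PolyTime.id.snd.fst)) Q fun x b a =>
      (hQ x b).trans (Nat.add_le_add_left (eval_le_eval Q (by rw [sz_pair]; omega)) _)).of_eq
    fun x => (foldl_replicate_unit _ _ _).symm

theorem PolyTime.succ {n : γ → ℕ} (hn : PolyTime n) : PolyTime fun x => n x + 1 :=
  ((PolyTime.const ()).pair hn).of_enc_eq fun _ => rfl

theorem PolyTime.pred {n : γ → ℕ} (hn : PolyTime n) : PolyTime fun x => n x - 1 :=
  (hn.units.tail).of_enc_eq fun x => by
    show Data.ofNat _ = Data.ofList _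
    rw [List.tail_replicate]
    induction n x - 1 with
    | zero => rfl
    | succ n ih => rw [List.replicate_succ, List.map_cons, Data.ofList, ← ih]; rfl

theorem PolyTime.add {m n : γ → ℕ} (hm : PolyTime m) (hn : PolyTime n) :
    PolyTime fun x => m x + n x :=
  (hn.iterate (f := fun _ b => b + 1) hm PolyTime.id.snd.succ 2
    fun x b => by simp [sz_nat]; omega).of_eq fun x => by
      induction n x with
      | zero => rfl
      | succ n ih => rw [Function.iterate_succ_apply', ← ih]; rfl

theorem PolyTime.sub {m n : γ → ℕ} (hm : PolyTime m) (hn : PolyTime n) :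
    PolyTime fun x => m x - n x :=
  (hn.iterate (f := fun _ b => b - 1) hm PolyTime.id.snd.pred 2
    fun x b => by simp [sz_nat]; omega).of_eq fun x => by
      induction n x with
      | zero => rfl
      | succ n ih => rw [Function.iterate_succ_apply', ← ih]; omega

theorem PolyTime.mul {m n : γ → ℕ} (hm : PolyTime m) (hn : PolyTime n) :
    PolyTime fun x => m x * n x := by
  obtain ⟨P, hP⟩ := hm.sz_le
  refine (hn.iterate (f := fun x b => b + m x) (PolyTime.const 0)
    (PolyTime.id.snd.add (hm.comp PolyTime.id.fst)) P fun x b => ?_).of_eq fun x => ?_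
  · have := hP x
    simp only [sz_nat] at *
    omega
  · induction n x with
    | zero => rfl
    | succ n ih => rw [Function.iterate_succ_apply', ← ih]; rfl

theorem PolyTime.decide_lt {m n : γ → ℕ} (hm : PolyTime m) (hn : PolyTime n) :
    PolyTime fun x => decide (m x < n x) :=
  ((hn.sub hm).decide_nil (b := fun x => decide (n x ≤ m x)) fun x => by
    rw [decide_eq_true_iff, ← Nat.sub_eq_zero_iff_le]
    cases n x - m x <;> simp [enc, Data.ofNat]).not.of_eq fun x => by
      rw [← decide_not]; simp

theorem PolyTime.decide_eq {m n : γ → ℕ} (hm : PolyTime m) (hn : PolyTime n) :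
    PolyTime fun x => decide (m x = n x) :=
  ((hm.decide_lt hn).not.and (hn.decide_lt hm).not).of_eq fun x => by
    rw [← decide_not, ← decide_not, ← Bool.decide_and, decide_eq_decide]; omega

theorem PolyTime.natPair {m n : γ → ℕ} (hm : PolyTime m) (hn : PolyTime n) :
    PolyTime fun x => Nat.pair (m x) (n x) :=
  ((hm.decide_lt hn).ite ((hn.mul hn).add hm) (((hm.mul hm).add hm).add hn)).of_eq fun x => by
    simp [Nat.pair]

theorem PolyTime.length {l : γ → List α} (hl : PolyTime l) : PolyTime fun x => (l x).length := by
  refine (PolyTime.foldl_of_growth (step := fun _ b _ => b + 1) hl (PolyTime.const 0)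
    PolyTime.id.snd.fst.succ 2 fun x b a => ?_).of_eq fun x => ?_
  · simp [sz_nat]; omega
  · simp

theorem PolyTime.sum {l : γ → List ℕ} (hl : PolyTime l) : PolyTime fun x => (l x).sum := by
  refine (PolyTime.foldl_of_growth (step := fun _ b a => b + a) hl (PolyTime.const 0)
    (PolyTime.id.snd.fst.add PolyTime.id.snd.snd) Polynomial.X fun x b a => ?_).of_eq fun x => ?_
  · simp [sz_nat, sz_pair]; omega
  · rw [List.sum_eq_foldl]

theorem PolyTime.drop {l : γ → List α} {n : γ → ℕ} (hl : PolyTime l) (hn : PolyTime n) :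
    PolyTime fun x => (l x).drop (n x) := by
  refine (hn.iterate (f := fun _ b => b.tail) hl PolyTime.id.snd.tail 0 fun x b => ?_).of_eq
    fun x => ?_
  · cases b <;> simp [sz_cons, sz_nil]
  · induction n x with
    | zero => rfl
    | succ n ih => rw [Function.iterate_succ_apply', ← ih, List.tail_drop]

theorem PolyTime.getElem? {l : γ → List α} {n : γ → ℕ} (hl : PolyTime l) (hn : PolyTime n) :
    PolyTime fun x => (l x)[n x]? :=
  (hl.drop hn).head?.of_eq fun x => by rw [List.head?_drop]

theorem PolyTime.optionGetD {o : γ → Option α} {d : γ → α} (ho : PolyTime o) (hd : PolyTime d) :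
    PolyTime fun x => (o x).getD (d x) :=
  (ho.optionElim hd (f := fun _ a => a) PolyTime.id.snd).of_eq fun x => by cases o x <;> rfl

/-- The list is extended by its own length again and again. The increment depends on the
accumulator, so `PolyTime.foldl` is used directly: all intermediate lists are ranges with at most
`N` entries of size at most `N`. -/
theorem PolyTime.range {n : γ → ℕ} (hn : PolyTime n) : PolyTime fun x => List.range (n x) := by
  obtain ⟨N, hN⟩ := hn.sz_le
  have hf (m : ℕ) : (List.replicate m ()).foldl (fun (b : List ℕ) _ => b ++ [b.length]) []
      = List.range m := by
    rw [foldl_replicate_unit]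
    induction m with
    | zero => rfl
    | succ m ih => rw [Function.iterate_succ_apply', ih, List.range_succ, List.length_range]
  refine (PolyTime.foldl (step := fun _ (b : List ℕ) (_ : Unit) => b ++ [b.length]) hn.units
    (PolyTime.const []) (PolyTime.id.snd.fst.append
      (PolyTime.id.snd.fst.length.cons (PolyTime.const []))) (1 + N * (1 + N))
    fun x l₁ l₂ h => ?_).of_eq fun x => (hf _).symm
  have hl₁ := List.replicate_eq_append_iff.1 h
  have hlen : l₁.length ≤ N.eval (sz x) := by
    have := hN x
    have := sz_nat (n x)
    omega
  rw [hl₁.2.1, hf]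
  refine (sz_le_of_forall (K := N.eval (sz x)) fun i hi => ?_).trans ?_
  · have := hN x
    have := List.mem_range.1 hi
    rw [sz_nat] at *
    omega
  · rw [List.length_range]
    simpa using hlen
end

/-! ### Reductions -/

theorem computable_pow {f : ℕ → ℕ} (hf : Computable f) (e : ℕ) : Computable fun k => f k ^ e := by
  induction e with
  | zero => simpa using Computable.const 1
  | succ e ih => simpa only [pow_succ] using Primrec.nat_mul.to_comp.comp ih hf

/-- Sum of the values of a function up to a bound. -/
def sumUpTo (f : ℕ → ℕ) (m : ℕ) : ℕ := m.rec (f 0) fun i s => s + f (i + 1)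

theorem computable_sumUpTo {f : ℕ → ℕ} (hf : Computable f) : Computable (sumUpTo f) :=
  Computable.nat_rec (f := fun m : ℕ => m) (g := fun _ => f 0)
    (h := fun _ q => q.2 + f (q.1 + 1)) Computable.id (Computable.const _)
    (Primrec.nat_add.to_comp.comp (Computable.snd.comp Computable.snd)
      (hf.comp (Computable.succ.comp (Computable.fst.comp Computable.snd)))).to₂

theorem le_sumUpTo (f : ℕ → ℕ) {i m : ℕ} (h : i ≤ m) : f i ≤ sumUpTo f m := by
  induction m with
  | zero => obtain rfl := Nat.le_zero.1 h; exact le_rfl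
  | succ m ih =>
    have hs : sumUpTo f (m + 1) = sumUpTo f m + f (m + 1) := rfl
    rcases Nat.le_succ_iff.1 h with h | rfl
    · have := ih h; omega
    · rw [Nat.succ_eq_add_one]; omega

/-- The bounds of the second reduction need not be monotone, and of the intermediate parameter only
an upper bound `g₁ k` is known; `sumUpTo` replaces them by computable bounds valid for all
parameters up to `g₁ k`. -/
theorem FptReducible.trans {P Q R : ParamProblem} (h₁ : FptReducible P Q)
    (h₂ : FptReducible Q R) : FptReducible P R := by
  obtain ⟨r₁, p₁, f₁, g₁, e₁, hf₁, hg₁, hy₁, hb₁, ht₁⟩ := h₁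
  obtain ⟨r₂, p₂, f₂, g₂, e₂, hf₂, hg₂, hy₂, hb₂, ht₂⟩ := h₂
  refine ⟨fun x => r₂ (r₁ x), .seq p₁ p₂,
    fun k => 1 + f₁ k + sumUpTo f₂ (g₁ k) * f₁ k ^ e₂, fun k => sumUpTo g₂ (g₁ k), e₁ + e₁ * e₂,
    ?_, (computable_sumUpTo hg₂).comp hg₁, ?_, ?_, ?_⟩
  · exact Primrec.nat_add.to_comp.comp (Primrec.nat_add.to_comp.comp (Computable.const 1) hf₁)
      (Primrec.nat_mul.to_comp.comp ((computable_sumUpTo hf₂).comp hg₁) (computable_pow hf₁ e₂))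
  · intro I k
    rw [hy₁, hy₂]
  · intro I k
    exact (hb₂ _ _).trans (le_sumUpTo g₂ (hb₁ I k))
  · intro I k
    obtain ⟨s, hs, hr₁⟩ := ht₁ I k
    obtain ⟨t, ht, hr₂⟩ := ht₂ (r₁ (I, k)).1 (r₁ (I, k)).2
    refine ⟨_, ?_, .seq hr₁ hr₂⟩
    set n := (P.enc I).size
    have hn : 1 ≤ n := Data.size_pos _
    have h0 := hr₁.size_le
    have h1 : (Q.enc (r₁ (I, k)).1).size ≤ f₁ k * n ^ e₁ := by
      simp only [ParamProblem.code, Data.size] at h0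
      omega
    have h2 : t ≤ sumUpTo f₂ (g₁ k) * (f₁ k * n ^ e₁) ^ e₂ :=
      ht.trans (Nat.mul_le_mul (le_sumUpTo f₂ (hb₁ I k)) (Nat.pow_le_pow_left h1 _))
    have h3 : n ^ e₁ ≤ n ^ (e₁ + e₁ * e₂) := Nat.pow_le_pow_right hn (by omega)
    have h4 : n ^ (e₁ * e₂) ≤ n ^ (e₁ + e₁ * e₂) := Nat.pow_le_pow_right hn (by omega)
    have h5 : 1 ≤ n ^ (e₁ + e₁ * e₂) := Nat.one_le_pow _ _ hn
    calc 1 + s + t ≤ 1 + f₁ k * n ^ e₁ + sumUpTo f₂ (g₁ k) * f₁ k ^ e₂ * n ^ (e₁ * e₂) := by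
          rw [mul_pow, ← pow_mul, ← mul_assoc] at h2
          omega
      _ ≤ n ^ (e₁ + e₁ * e₂) + f₁ k * n ^ (e₁ + e₁ * e₂)
          + sumUpTo f₂ (g₁ k) * f₁ k ^ e₂ * n ^ (e₁ + e₁ * e₂) := by gcongr
      _ = _ := by ring

/-- A polynomial-time many-one reduction whose new parameter is bounded is an fpt-reduction. -/
theorem FptReducible.of_runs {P Q : ParamProblem} (r : P.Inst × ℕ → Q.Inst × ℕ) (g : ℕ → ℕ)
    (hr : ∃ (p : Prog) (B : Polynomial ℕ), ∀ x, ∃ t ≤ B.eval (P.code x).size,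
      Runs p (P.code x) (Q.code (r x)) t)
    (hg : Computable g) (hy : ∀ I k, P.Yes I k ↔ Q.Yes (r (I, k)).1 (r (I, k)).2)
    (hb : ∀ I k, (r (I, k)).2 ≤ g k) : FptReducible P Q := by
  obtain ⟨p, B, hp⟩ := hr
  refine ⟨r, p, fun k => B.eval 1 * (2 * k + 3) ^ B.natDegree, g, B.natDegree, ?_, hg, hy, hb, ?_⟩
  · exact Primrec.nat_mul.to_comp.comp (Computable.const _) (computable_pow
      (Primrec.nat_add.comp (Primrec.nat_mul.comp (Primrec.const 2) Primrec.id)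
        (Primrec.const 3)).to_comp _)
  · intro I k
    obtain ⟨t, ht, hr⟩ := hp (I, k)
    refine ⟨t, ?_, hr⟩
    have hn : 1 ≤ (P.enc I).size := Data.size_pos _
    -- The code adds one node and the `2 * k + 1` nodes of the unary parameter to the main part,
    -- whose size is at least `1`.
    have h1 : (P.code (I, k)).size ≤ (2 * k + 3) * (P.enc I).size := by
      simp only [ParamProblem.code, Data.size, Data.size_ofNat]
      nlinarith
    refine (ht.trans (eval_le_eval B h1)).trans ((eval_le_mul_pow B (by positivity)).trans ?_)
    rw [mul_pow, mul_assoc]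

/-! ### Timelines as satisfying assignments -/

/-- A formula whose satisfying assignments of weight `M + 3` are the timelines with time slots
`0, …, M + 2`. Option number `a` is chosen in slot `t` if variable `Nat.pair t a` is true. Options are
described by the value they require (`kpre`) and the value they set (`kpost`) for each of `n`
variables, and `0` means that there is none. -/
def timelineCNF (n L M : ℕ) (kpre kpost : ℕ → ℕ → ℕ) : CNF :=
  [[(Nat.pair 0 0, true)], [(Nat.pair (M + 2) 1, true)],
    (List.range (M + 1)).map fun t => (Nat.pair (t + 1) 2, true)] ++
  ((List.range (M + 1)).map (fun t =>
    (List.range (L - 2)).map fun a => (Nat.pair (t + 1) (a + 2), true)) ++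
  (List.range (M + 3)).flatMap fun t => (List.range t).flatMap fun u =>
    (List.range L).flatMap fun a => (List.range L).flatMap fun b =>
      ((List.range n).filter fun v =>
        !decide (kpre a v = 0) && (!decide (kpost b v = 0) && !decide (kpre a v = kpost b v))).map
        fun v => (Nat.pair t a, false) :: (Nat.pair u b, false) ::
          ((List.range t).filter fun s => decide (u < s)).flatMap fun s =>
            ((List.range L).filter fun d => decide (kpost d v = kpre a v)).map fun d =>
              (Nat.pair s d, true))

/-- The value of variable `v` before slot `t`, if option `o s` is chosen in slot `s`. -/
def keyAt (kpost : ℕ → ℕ → ℕ) (o : ℕ → ℕ) : ℕ → ℕ → ℕ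
  | 0, _ => 0
  | t + 1, v => if kpost (o t) v = 0 then keyAt kpost o t v else kpost (o t) v

/-- Option `0` comes first and option `1` last; the options chosen in between have larger numbers,
and option `2` is among them; all requirements are met. -/
structure IsTimeline (n L M : ℕ) (kpre kpost : ℕ → ℕ → ℕ) (o : ℕ → ℕ) : Prop where
  first : o 0 = 0
  last : o (M + 2) = 1
  middle : ∀ t ≤ M, 2 ≤ o (t + 1) ∧ o (t + 1) < L
  exists_two : ∃ t ≤ M, o (t + 1) = 2
  pre : ∀ t ≤ M + 2, ∀ v < n, kpre (o t) v ≠ 0 → keyAt kpost o t v = kpre (o t) v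

theorem exists_last_setter {kpost : ℕ → ℕ → ℕ} {o : ℕ → ℕ} {v : ℕ} (h : kpost (o 0) v ≠ 0) (t : ℕ) :
    ∃ u < t + 1, kpost (o u) v ≠ 0 ∧ keyAt kpost o (t + 1) v = kpost (o u) v ∧
      ∀ s, u < s → s < t + 1 → kpost (o s) v = 0 := by
  induction t with
  | zero => exact ⟨0, by omega, h, by simp [keyAt, h], fun s _ _ => by omega⟩
  | succ t ih =>
    by_cases h1 : kpost (o (t + 1)) v = 0
    · obtain ⟨u, hu, hu1, hu2, hu3⟩ := ih
      refine ⟨u, by omega, hu1, by rw [keyAt, if_pos h1, hu2], fun s hs ht => ?_⟩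
      rcases Nat.lt_succ_iff_lt_or_eq.1 ht with ht | rfl
      · exact hu3 s hs ht
      · exact h1
    · exact ⟨t + 1, by omega, h1, by rw [keyAt, if_neg h1], fun s _ _ => by omega⟩

/-- If the current value is not the one set in slot `u`, it must have been set after `u`. -/
theorem exists_setter_between {kpost : ℕ → ℕ → ℕ} {o : ℕ → ℕ} {u v : ℕ} (h : kpost (o u) v ≠ 0)
    {t : ℕ} (hut : u < t) (hne : keyAt kpost o t v ≠ kpost (o u) v) :
    ∃ s, u < s ∧ s < t ∧ kpost (o s) v = keyAt kpost o t v := by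
  induction t with
  | zero => omega
  | succ t ih =>
    rw [keyAt] at hne ⊢
    rcases Nat.lt_succ_iff_lt_or_eq.1 hut with ht | rfl
    · by_cases h1 : kpost (o t) v = 0
      · rw [if_pos h1] at hne ⊢
        obtain ⟨s, h2, h3, h4⟩ := ih ht hne
        exact ⟨s, h2, by omega, h4⟩
      · rw [if_neg h1]
        exact ⟨t, ht, by omega, rfl⟩
    · simp [h] at hne

theorem CNF.mem_vars {F : CNF} {x : ℕ} : x ∈ F.vars ↔ ∃ C ∈ F, ∃ l ∈ C, l.1 = x := by
  simp only [CNF.vars, List.mem_toFinset, List.mem_map, List.mem_flatten]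
  exact ⟨fun ⟨l, ⟨C, h1, h2⟩, h3⟩ => ⟨C, h1, l, h2, h3⟩, fun ⟨C, h1, l, h2, h3⟩ => ⟨l, ⟨C, h1, h2⟩, h3⟩⟩

theorem mem_timelineCNF {n L M : ℕ} {kpre kpost : ℕ → ℕ → ℕ} {C : Clause} :
    C ∈ timelineCNF n L M kpre kpost ↔
      C = [(Nat.pair 0 0, true)] ∨ C = [(Nat.pair (M + 2) 1, true)] ∨
      C = (List.range (M + 1)).map (fun t => (Nat.pair (t + 1) 2, true)) ∨
      (∃ t < M + 1, (List.range (L - 2)).map (fun a => (Nat.pair (t + 1) (a + 2), true)) = C) ∨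
      ∃ t < M + 3, ∃ u < t, ∃ a < L, ∃ b < L, ∃ v < n,
        kpre a v ≠ 0 ∧ kpost b v ≠ 0 ∧ kpre a v ≠ kpost b v ∧
        (Nat.pair t a, false) :: (Nat.pair u b, false) ::
          (((List.range t).filter fun s => decide (u < s)).flatMap fun s =>
            ((List.range L).filter fun d => decide (kpost d v = kpre a v)).map fun d =>
              (Nat.pair s d, true)) = C := by
  simp only [timelineCNF, List.mem_append, List.mem_cons, List.mem_map, List.mem_flatMap,
    List.mem_filter, List.mem_range, List.not_mem_nil, or_false, or_assoc, Bool.and_eq_true,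
    Bool.not_eq_true', decide_eq_false_iff_not, ne_eq, and_assoc]

/-- The weight forces a model to be the graph of a choice function. The repair clauses then say that
no requirement fails: apply them to the last slot that set the variable. Such a slot exists because
option `0` sets every variable. -/
theorem timelineCNF_iff {n L M : ℕ} {kpre kpost : ℕ → ℕ → ℕ} (hL : 2 ≤ L)
    (hpre : ∀ v < n, kpre 0 v = 0) (hpost : ∀ v < n, kpost 0 v ≠ 0) :
    (∃ S : Finset ℕ, S ⊆ (timelineCNF n L M kpre kpost).vars ∧ S.card = M + 3 ∧
      (timelineCNF n L M kpre kpost).SatisfiedBy S) ↔ ∃ o, IsTimeline n L M kpre kpost o := by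
  constructor
  · rintro ⟨S, -, hcard, hS⟩
    -- Stated for all `t` so that a total function can be chosen; slots behind `M + 2` get the
    -- irrelevant value `0`.
    have hch : ∀ t, ∃ a, (t = 0 → a = 0) ∧ (t = M + 2 → a = 1) ∧
        (0 < t → t < M + 2 → 2 ≤ a ∧ a < L) ∧ (t < M + 3 → Nat.pair t a ∈ S) := by
      intro t
      rcases Nat.eq_zero_or_pos t with rfl | h0
      · obtain ⟨l, hl, h⟩ := hS _ (mem_timelineCNF.2 (.inl rfl))
        simp only [List.mem_singleton] at hl
        subst hl
        exact ⟨0, by simp, by simp, by simp, fun _ => by simpa using h⟩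
      rcases lt_trichotomy t (M + 2) with h1 | rfl | h1
      · obtain ⟨l, hl, h⟩ := hS _ (mem_timelineCNF.2
          (.inr (.inr (.inr (.inl ⟨t - 1, by omega, rfl⟩)))))
        simp only [List.mem_map, List.mem_range] at hl
        obtain ⟨a, ha, rfl⟩ := hl
        have ht : t - 1 + 1 = t := by omega
        rw [ht] at h
        exact ⟨a + 2, by omega, by omega, by omega, fun _ => by simpa using h⟩
      · obtain ⟨l, hl, h⟩ := hS _ (mem_timelineCNF.2 (.inr (.inl rfl)))
        simp only [List.mem_singleton] at hl
        subst hl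
        exact ⟨1, by simp, by simp, by simp, fun _ => by simpa using h⟩
      · exact ⟨0, by omega, by omega, by omega, by omega⟩
    choose o h0 h1 hmid hmem using hch
    -- The chosen variables are already `M + 3` distinct elements of `S`, so there are no others.
    have himg : (Finset.range (M + 3)).image (fun t => Nat.pair t (o t)) = S := by
      apply Finset.eq_of_subset_of_card_le
      · intro x hx
        obtain ⟨t, ht, rfl⟩ := Finset.mem_image.1 hx
        exact hmem t (Finset.mem_range.1 ht)
      · rw [Finset.card_image_of_injective, Finset.card_range, hcard]
        intro s t hst
        exact (Nat.pair_eq_pair.1 hst).1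
    have hiff : ∀ {t a}, Nat.pair t a ∈ S → a = o t := by
      intro t a h
      rw [← himg] at h
      obtain ⟨s, -, hs⟩ := Finset.mem_image.1 h
      obtain ⟨rfl, rfl⟩ := Nat.pair_eq_pair.1 hs
      rfl
    have hlt : ∀ t < M + 3, o t < L := by
      intro t ht
      have a0 := h0 t
      have a1 := h1 t
      have a2 := hmid t
      omega
    refine ⟨o, h0 0 rfl, h1 _ rfl, fun t ht => hmid _ (by omega) (by omega), ?_, ?_⟩
    · obtain ⟨l, hl, h⟩ := hS _ (mem_timelineCNF.2 (.inr (.inr (.inl rfl))))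
      simp only [List.mem_map, List.mem_range] at hl
      obtain ⟨t, ht, rfl⟩ := hl
      exact ⟨t, by omega, (hiff (by simpa using h)).symm⟩
    · intro t ht v hv hne
      by_contra hcur
      cases t with
      | zero => exact hne (by rw [h0 0 rfl, hpre v hv])
      | succ t =>
        -- The last setter `u` supplies the present, wrong value, so its clause with slot `t + 1`
        -- belongs to the formula. A true positive literal of that clause would be a later setter.
        obtain ⟨u, hu, hu1, hu2, hu3⟩ := exists_last_setter (kpost := kpost) (o := o) (v := v)
          (by rw [h0 0 rfl]; exact hpost v hv) t
        obtain ⟨l, hl, h⟩ := hS _ (mem_timelineCNF.2 (.inr (.inr (.inr (.inr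
          ⟨t + 1, by omega, u, hu, o (t + 1), hlt _ (by omega), o u, hlt _ (by omega), v, hv, hne,
            hu1, by rw [← hu2]; exact Ne.symm hcur, rfl⟩)))))
        simp only [List.mem_cons, List.mem_flatMap, List.mem_map, List.mem_filter,
          List.mem_range, decide_eq_true_eq] at hl
        rcases hl with rfl | rfl | ⟨s, ⟨hs1, hs2⟩, d, ⟨hd, hd2⟩, rfl⟩
        · simp at h
          exact h (hmem _ (by omega))
        · simp at h
          exact h (hmem _ (by omega))
        · have := hiff (a := d) (t := s) (by simpa using h)
          subst this
          exact hne (by rw [← hd2]; exact hu3 s hs2 hs1)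
  · rintro ⟨o, ho⟩
    set S := (Finset.range (M + 3)).image fun t => Nat.pair t (o t) with hS
    have hmem : ∀ {t a}, Nat.pair t a ∈ S ↔ t < M + 3 ∧ a = o t := by
      intro t a
      rw [hS, Finset.mem_image]
      constructor
      · rintro ⟨s, hs, h⟩
        obtain ⟨rfl, rfl⟩ := Nat.pair_eq_pair.1 h
        exact ⟨Finset.mem_range.1 hs, rfl⟩
      · rintro ⟨h, rfl⟩
        exact ⟨t, Finset.mem_range.2 h, rfl⟩
    refine ⟨S, ?_, ?_, ?_⟩
    · intro x hx
      obtain ⟨t, ht, rfl⟩ := Finset.mem_image.1 hx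
      rw [Finset.mem_range] at ht
      rw [CNF.mem_vars]
      rcases Nat.eq_zero_or_pos t with rfl | h0
      · exact ⟨_, mem_timelineCNF.2 (.inl rfl), (_, true), List.mem_singleton_self _,
          by rw [ho.first]⟩
      by_cases h1 : t = M + 2
      · subst h1
        exact ⟨_, mem_timelineCNF.2 (.inr (.inl rfl)), (_, true), List.mem_singleton_self _,
          by rw [ho.last]⟩
      · obtain ⟨t, rfl⟩ := Nat.exists_eq_succ_of_ne_zero h0.ne'
        have := ho.middle t (by omega)
        refine ⟨_, mem_timelineCNF.2 (.inr (.inr (.inr (.inl ⟨t, by omega, rfl⟩)))),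
          (Nat.pair (t + 1) (o (t + 1)), true), ?_, rfl⟩
        simp only [List.mem_map, List.mem_range]
        exact ⟨o (t + 1) - 2, by omega, by congr; omega⟩
    · rw [hS, Finset.card_image_of_injective, Finset.card_range]
      intro s t hst
      exact (Nat.pair_eq_pair.1 hst).1
    · intro C hC
      rcases mem_timelineCNF.1 hC with rfl | rfl | rfl | ⟨t, ht, rfl⟩ |
        ⟨t, ht, u, hu, a, ha, b, hb, v, hv, hv1, hv2, hv3, rfl⟩
      · exact ⟨_, List.mem_singleton_self _, by simp [hmem, ho.first]⟩
      · exact ⟨_, List.mem_singleton_self _, by simp [hmem, ho.last]⟩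
      · obtain ⟨t, ht, h2⟩ := ho.exists_two
        exact ⟨(Nat.pair (t + 1) 2, true), List.mem_map.2 ⟨t, List.mem_range.2 (by omega), rfl⟩,
          by simp [hmem, h2]; omega⟩
      · have := ho.middle t (by omega)
        refine ⟨(Nat.pair (t + 1) (o (t + 1)), true), ?_, by simp [hmem]; omega⟩
        simp only [List.mem_map, List.mem_range]
        exact ⟨o (t + 1) - 2, by omega, by congr; omega⟩
      · by_cases h1 : a = o t
        swap
        · exact ⟨(Nat.pair t a, false), by simp, by simp [hmem, h1]⟩
        by_cases h2 : b = o u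
        swap
        · exact ⟨(Nat.pair u b, false), by simp, by simp [hmem, h2]⟩
        subst h1 h2
        have h3 := ho.pre t (by omega) v hv hv1
        obtain ⟨s, hs1, hs2, hs3⟩ := exists_setter_between hv2 hu (by rw [h3]; exact hv3)
        refine ⟨(Nat.pair s (o s), true), ?_, by simp [hmem]; omega⟩
        simp only [List.mem_cons, List.mem_flatMap, List.mem_map, List.mem_filter,
          List.mem_range, decide_eq_true_eq]
        refine .inr (.inr ⟨s, ⟨hs2, hs1⟩, o s, ⟨?_, by rw [hs3, h3]⟩, rfl⟩)
        -- Since `u < s < t`, the slot `s` is neither the first nor the last, so its option number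
        -- is below `L`.
        have := ho.middle (s - 1)
        rw [Nat.sub_add_cancel (by omega)] at this
        exact (this (by omega)).2

/-! ### Case modification and timelines -/

theorem State.run_append {X : VarSystem} (s : State X) (p q : List (Act X)) :
    State.run s (p ++ q) = State.run (State.run s p) q := List.foldl_append

/-- All actions of a sequence are applicable when their turn comes. -/
def State.Applicable {X : VarSystem} : State X → List (Act X) → Prop
  | _, [] => True
  | s, a :: l => s.Satisfies a.pre ∧ State.Applicable (s.apply a) l

theorem State.applicable_append {X : VarSystem} {s : State X} {p q : List (Act X)} :
    State.Applicable s (p ++ q) ↔ State.Applicable s p ∧ State.Applicable (State.run s p) q := by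
  induction p generalizing s with
  | nil => simp [State.Applicable, State.run]
  | cons a p ih => simp only [List.cons_append, State.Applicable, ih, and_assoc]; rfl

theorem State.Applicable.satisfies {X : VarSystem} {s : State X} {p : List (Act X)}
    (h : State.Applicable s p) {t : ℕ} (ht : t < p.length) :
    State.Satisfies (State.run s (p.take t)) p[t].pre := by
  induction p generalizing s t with
  | nil => simp at ht
  | cons a p ih =>
    cases t with
    | zero => exact h.1
    | succ t => exact ih h.2 (by simpa using ht)

/-- The action that is always applicable and has no effect. -/
def Act.noop (X : VarSystem) : Act X := ⟨fun _ => none, fun _ => none⟩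

theorem State.satisfies_none {X : VarSystem} (s : State X) : s.Satisfies fun _ => none :=
  fun _ _ h => by simp at h

theorem State.apply_noop {X : VarSystem} (s : State X) : s.apply (Act.noop X) = s := by
  rw [State.apply, if_pos]
  · rfl
  · exact s.satisfies_none

theorem State.satisfies_some {X : VarSystem} {s t : State X} :
    s.Satisfies (fun v => some (t v)) ↔ s = t := by
  constructor
  · intro h
    funext v
    exact h v _ rfl
  · rintro rfl v x h
    simpa using h

theorem State.apply_some {X : VarSystem} {s t : State X} {p : PartialState X} (h : s.Satisfies p) :
    s.apply ⟨p, fun v => some (t v)⟩ = t := by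
  unfold State.apply
  rw [if_pos h]
  rfl

/-! ### Partial states as lists of numbers, and the options of a timeline. -/

/-- A partial state as a list. -/
def rawPartial {X : VarSystem} (p : PartialState X) : List (Option ℕ) :=
  List.ofFn fun v => (p v).map Fin.val

/-- An action as a pair of lists. -/
def rawAct {X : VarSystem} (a : Act X) : List (Option ℕ) × List (Option ℕ) :=
  (rawPartial a.pre, rawPartial a.post)

/-- The entry of a partial state for a variable, where `0` stands for an undefined entry. -/
def entryKey (p : List (Option ℕ)) (v : ℕ) : ℕ := (p[v]?.getD none).elim 0 fun x => x + 1

/-- The entry of the precondition of an action of a list. -/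
def preKey (O : List (List (Option ℕ) × List (Option ℕ))) (a v : ℕ) : ℕ :=
  entryKey (O[a]?.getD ([], [])).1 v

/-- The entry of the postcondition of an action of a list. -/
def postKey (O : List (List (Option ℕ) × List (Option ℕ))) (a v : ℕ) : ℕ :=
  entryKey (O[a]?.getD ([], [])).2 v

theorem entryKey_rawPartial {X : VarSystem} (p : PartialState X) (v : Fin X.num) :
    entryKey (rawPartial p) v = (p v).elim 0 fun x => x.val + 1 := by
  simp only [entryKey, rawPartial, List.getElem?_ofFn, v.isLt, dite_true, Option.getD_some]
  cases p v <;> rfl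

section
variable (C : CaseModInstance)

/-- The state that the stored plan leads to. -/
def CaseModInstance.planState : State C.X := State.run C.stored.init C.plan

/-- The options for the slots of a timeline: an action that sets the initial state, one that requires
the goal, one that has the effect of the stored plan, one without effect, and the glue actions. -/
def CaseModInstance.options : List (Act C.X) :=
  ⟨fun _ => none, fun v => some (C.target.init v)⟩ :: ⟨C.target.goal, fun _ => none⟩ ::
    ⟨fun v => some (C.stored.init v), fun v => some (C.planState v)⟩ :: Act.noop C.X :: C.glueActs

/-- The option with a given number. -/
def CaseModInstance.option (a : ℕ) : Act C.X := C.options[a]?.getD (Act.noop C.X)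

/-- The options as pairs of lists. -/
def CaseModInstance.rawOptions : List (List (Option ℕ) × List (Option ℕ)) := C.options.map rawAct

variable {C}

theorem preKey_rawOptions (a : ℕ) (v : Fin C.X.num) :
    preKey C.rawOptions a v = ((C.option a).pre v).elim 0 fun x => x.val + 1 := by
  rw [preKey, CaseModInstance.rawOptions, CaseModInstance.option, List.getElem?_map]
  cases C.options[a]? with
  | none => rfl
  | some b => exact entryKey_rawPartial _ _

theorem postKey_rawOptions (a : ℕ) (v : Fin C.X.num) :
    postKey C.rawOptions a v = ((C.option a).post v).elim 0 fun x => x.val + 1 := by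
  rw [postKey, CaseModInstance.rawOptions, CaseModInstance.option, List.getElem?_map]
  cases C.options[a]? with
  | none => rfl
  | some b => exact entryKey_rawPartial _ _

variable (C) in
/-- The state before slot `t`, if option `o s` is chosen in slot `s`. -/
def CaseModInstance.stateAt (o : ℕ → ℕ) (t : ℕ) : State C.X :=
  State.run C.target.init ((List.range t).map fun s => C.option (o s))

theorem stateAt_succ (o : ℕ → ℕ) (t : ℕ) :
    C.stateAt o (t + 1) = (C.stateAt o t).apply (C.option (o t)) := by
  simp only [CaseModInstance.stateAt, List.range_succ, List.map_append, State.run_append]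
  rfl

theorem stateAt_one {o : ℕ → ℕ} (h : o 0 = 0) : C.stateAt o 1 = C.target.init := by
  rw [stateAt_succ, h]
  exact State.apply_some (State.satisfies_none _)

/-- Keys are values plus one, as `0` means undefined. `keyAt` overwrites unconditionally, whereas an
inapplicable action changes nothing, so the earlier options must be applicable. Before slot `0` no
key is set, hence the shift to `t + 1`. -/
theorem keyAt_eq {o : ℕ → ℕ} (h0 : o 0 = 0) {t : ℕ}
    (h : ∀ s < t + 1, (C.stateAt o s).Satisfies (C.option (o s)).pre) (v : Fin C.X.num) :
    keyAt (postKey C.rawOptions) o (t + 1) v = (C.stateAt o (t + 1) v).val + 1 := by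
  induction t with
  | zero =>
    rw [stateAt_one h0, keyAt, postKey_rawOptions, h0]
    rfl
  | succ t ih =>
    rw [stateAt_succ, State.apply, if_pos (h _ (by omega)), keyAt, postKey_rawOptions,
      ih fun s hs => h s (by omega)]
    cases (C.option (o (t + 1))).post v <;> simp

/-- Keys describe the true states only as long as all earlier options were applicable, so
applicability is derived slot by slot by strong induction. -/
theorem satisfies_iff {o : ℕ → ℕ} (h0 : o 0 = 0) (N : ℕ) :
    (∀ t ≤ N, ∀ v < C.X.num, preKey C.rawOptions (o t) v ≠ 0 →
      keyAt (postKey C.rawOptions) o t v = preKey C.rawOptions (o t) v) ↔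
    ∀ t ≤ N, (C.stateAt o t).Satisfies (C.option (o t)).pre := by
  constructor
  · intro h t ht
    induction t using Nat.strong_induction_on with
    | _ t ih =>
      cases t with
      | zero => rw [h0]; exact State.satisfies_none _
      | succ t =>
        intro v x hx
        have h1 := h (t + 1) ht v v.isLt
        rw [keyAt_eq h0 (fun s hs => ih s hs (by omega)) v, preKey_rawOptions, hx] at h1
        exact Fin.ext (by simpa using h1)
  · intro h t ht v hv hne
    cases t with
    | zero =>
      rw [h0, preKey_rawOptions _ ⟨v, hv⟩] at hne
      exact absurd rfl hne
    | succ t =>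
      have h1 := keyAt_eq h0 (fun s hs => h s (by omega)) ⟨v, hv⟩ (t := t)
      have h2 := preKey_rawOptions (C := C) (o (t + 1)) ⟨v, hv⟩
      simp only at h1 h2
      rw [h2] at hne ⊢
      rw [h1]
      cases hx : (C.option (o (t + 1))).pre ⟨v, hv⟩ with
      | none => rw [hx] at hne; exact absurd rfl hne
      | some x => rw [h _ ht _ _ hx]; rfl

theorem option_mem_glueActs {a : ℕ} (h : 4 ≤ a) (ha : a < C.options.length) :
    C.option a ∈ C.glueActs := by
  obtain ⟨a, rfl⟩ := Nat.exists_eq_add_of_le' h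
  have h1 : a < C.glueActs.length := by
    simp only [CaseModInstance.options, List.length_cons] at ha
    omega
  have h2 : C.option (a + 4) = C.glueActs[a] := by
    simp [CaseModInstance.option, CaseModInstance.options, h1]
  rw [h2]
  exact List.getElem_mem h1

theorem exists_option_eq {a : Act C.X} (h : a ∈ C.glueActs) :
    ∃ i, 3 ≤ i ∧ i < C.options.length ∧ C.option i = a := by
  obtain ⟨i, hi, rfl⟩ := List.getElem_of_mem h
  refine ⟨i + 4, by omega, by simp [CaseModInstance.options]; omega, ?_⟩
  simp [CaseModInstance.option, CaseModInstance.options, hi]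

/-- Reading the slots from the left, either the plan has not been used and the glue so far leads to
the current state, or `g₁` leads to the stored initial state and `g₂` from the result of the plan to
the current state. The slot of the plan accounts for the `+ 1`, which leaves at most `M` glue steps
at `t = M + 1`. -/
theorem glue_of_timeline {M : ℕ} {o : ℕ → ℕ} (h0 : o 0 = 0)
    (hmid : ∀ t ≤ M, 2 ≤ o (t + 1) ∧ o (t + 1) < C.options.length)
    (hsat : ∀ t ≤ M + 2, (C.stateAt o t).Satisfies (C.option (o t)).pre) {t : ℕ} (ht : t ≤ M + 1) :
    ((∃ g : List (Act C.X), (∀ a ∈ g, a ∈ C.glueActs) ∧ g.length ≤ t ∧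
        State.run C.target.init g = C.stateAt o (t + 1)) ∧ ∀ s < t, o (s + 1) ≠ 2) ∨
    ∃ g₁ g₂ : List (Act C.X), (∀ a ∈ g₁ ++ g₂, a ∈ C.glueActs) ∧ g₁.length + g₂.length + 1 ≤ t ∧
        State.run C.target.init g₁ = C.stored.init ∧
        State.run C.planState g₂ = C.stateAt o (t + 1) := by
  induction t with
  | zero => exact .inl ⟨⟨[], by simp, le_rfl, (stateAt_one h0).symm⟩, by omega⟩
  | succ t ih =>
    have ih := ih (by omega)
    have hm := hmid t (by omega)
    have hs := hsat (t + 1) (by omega)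
    rw [stateAt_succ]
    by_cases h2 : o (t + 1) = 2
    · rw [h2] at hs ⊢
      have hJ : C.stateAt o (t + 1) = C.stored.init := State.satisfies_some.1 hs
      have hK : (C.stateAt o (t + 1)).apply (C.option 2) = C.planState := State.apply_some hs
      rw [hK]
      rcases ih with ⟨⟨g, hg, hlen, hrun⟩, -⟩ | ⟨g₁, g₂, hg, hlen, hrun, -⟩
      · exact .inr ⟨g, [], by simpa using hg, by simpa using hlen, by rw [hrun, hJ], rfl⟩
      -- A repeated use of the plan ends in the same state as the first one, so the glue steps in
      -- between are dropped.
      · exact .inr ⟨g₁, [], fun a ha => hg a (by simp at ha; simp [ha]), by simp; omega, hrun, rfl⟩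
    by_cases h3 : o (t + 1) = 3
    · rw [h3, show C.option 3 = Act.noop C.X from rfl, State.apply_noop]
      rcases ih with ⟨⟨g, hg, hlen, hrun⟩, hn⟩ | ⟨g₁, g₂, hg, hlen, hrun, hrun₂⟩
      · refine .inl ⟨⟨g, hg, by omega, hrun⟩, fun s hs => ?_⟩
        rcases Nat.lt_succ_iff_lt_or_eq.1 hs with hs | rfl
        · exact hn s hs
        · exact h2
      · exact .inr ⟨g₁, g₂, hg, by omega, hrun, hrun₂⟩
    · have hmem := option_mem_glueActs (C := C) (a := o (t + 1)) (by omega) hm.2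
      rcases ih with ⟨⟨g, hg, hlen, hrun⟩, hn⟩ | ⟨g₁, g₂, hg, hlen, hrun, hrun₂⟩
      · refine .inl ⟨⟨g ++ [C.option (o (t + 1))], ?_, by simpa using hlen, ?_⟩, fun s hs => ?_⟩
        · intro a ha
          rcases List.mem_append.1 ha with ha | ha
          · exact hg a ha
          · rwa [List.mem_singleton.1 ha]
        · rw [State.run_append, hrun]; rfl
        · rcases Nat.lt_succ_iff_lt_or_eq.1 hs with hs | rfl
          · exact hn s hs
          · exact h2
      · refine .inr ⟨g₁, g₂ ++ [C.option (o (t + 1))], ?_, by simp; omega, hrun, ?_⟩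
        · intro a ha
          rw [← List.append_assoc] at ha
          rcases List.mem_append.1 ha with ha | ha
          · exact hg a ha
          · rwa [List.mem_singleton.1 ha]
        · rw [State.run_append, hrun₂]; rfl

/-- Each action that is inapplicable at its turn is replaced by the idle option, number `3`; the
states passed through stay the same. -/
theorem exists_applicable (g : List (Act C.X)) (hg : ∀ a ∈ g, a ∈ C.glueActs) (s : State C.X) :
    ∃ w : List ℕ, w.length = g.length ∧ (∀ a ∈ w, 3 ≤ a ∧ a < C.options.length) ∧
      State.Applicable s (w.map C.option) ∧ State.run s (w.map C.option) = State.run s g := by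
  induction g generalizing s with
  | nil => exact ⟨[], rfl, by simp, trivial, rfl⟩
  | cons a g ih =>
    obtain ⟨w, hlen, hw, happ, hrun⟩ := ih (fun b hb => hg b (by simp [hb])) (s.apply a)
    by_cases h : s.Satisfies a.pre
    · obtain ⟨i, hi, hi2, rfl⟩ := exists_option_eq (hg a (by simp))
      exact ⟨i :: w, by simp [hlen], by simpa using ⟨⟨hi, hi2⟩, hw⟩, ⟨h, happ⟩, hrun⟩
    · have h1 : s.apply a = s := by rw [State.apply, if_neg h]
      have h2 : s.apply (C.option 3) = s := State.apply_noop s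
      refine ⟨3 :: w, by simp [hlen], ?_, ⟨State.satisfies_none _, ?_⟩, ?_⟩
      · simpa using ⟨by simp [CaseModInstance.options], hw⟩
      · rw [h1] at happ; rwa [h2]
      · show State.run (s.apply (C.option 3)) _ = State.run (s.apply a) g
        rw [h2, ← hrun, h1]

theorem applicable_replicate_noop (m : ℕ) (s : State C.X) :
    State.Applicable s ((List.replicate m 3).map C.option) ∧
      State.run s ((List.replicate m 3).map C.option) = s := by
  induction m with
  | zero => exact ⟨trivial, rfl⟩
  | succ m ih =>
    have h : s.apply (C.option 3) = s := State.apply_noop s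
    rw [List.replicate_succ, List.map_cons]
    refine ⟨⟨State.satisfies_none _, ?_⟩, ?_⟩
    · rw [h]; exact ih.1
    · show State.run (s.apply (C.option 3)) _ = s
      rw [h]; exact ih.2

theorem stateAt_getD {w : List ℕ} {t : ℕ} (ht : t ≤ w.length) :
    C.stateAt (fun t => w[t]?.getD 0) t = State.run C.target.init ((w.take t).map C.option) := by
  have h : (List.range t).map (fun s => w[s]?.getD 0) = w.take t := by
    apply List.ext_getElem
    · simp [ht]
    · intro i h1 h2
      simp at h1 h2
      simp [h2.2]
  rw [CaseModInstance.stateAt, ← h, List.map_map]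
  rfl

theorem solvable_iff_timeline (M : ℕ) : C.Solvable M ↔
    ∃ o, IsTimeline C.X.num C.options.length M (preKey C.rawOptions) (postKey C.rawOptions) o := by
  constructor
  · rintro ⟨g, hg, hlen, i, hi, ⟨-, hgoal⟩, hJ⟩
    obtain ⟨w₁, hl₁, hw₁, ha₁, hr₁⟩ := exists_applicable (C := C) (g.take i)
      (fun a ha => hg a (List.mem_of_mem_take ha)) C.target.init
    obtain ⟨w₂, hl₂, hw₂, ha₂, hr₂⟩ := exists_applicable (C := C) (g.drop i)
      (fun a ha => hg a (List.mem_of_mem_drop ha)) C.planState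
    have hfin : (State.run C.planState (g.drop i)).Satisfies C.target.goal := by
      rwa [State.run_append, State.run_append, hJ] at hgoal
    have hrep := applicable_replicate_noop (C := C) (M - g.length)
      (State.run C.planState (g.drop i))
    -- The middle slots: glue, the plan, glue, and idle options that fill up to `M + 1` slots.
    set mid := w₁ ++ (2 :: (w₂ ++ List.replicate (M - g.length) 3)) with hmid
    have hmidlen : mid.length = M + 1 := by
      simp [hmid, hl₁, hl₂]
      omega
    have hmidmem : ∀ a ∈ mid, 2 ≤ a ∧ a < C.options.length := by
      intro a ha
      simp only [hmid, List.mem_append, List.mem_cons, List.mem_replicate] at ha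
      rcases ha with ha | rfl | ha | ⟨-, rfl⟩
      · have := hw₁ a ha; omega
      · simp [CaseModInstance.options]
      · have := hw₂ a ha; omega
      · simp [CaseModInstance.options]
    have happ : State.Applicable C.target.init ((0 :: (mid ++ [1])).map C.option) := by
      have h0 : C.target.init.apply (C.option 0) = C.target.init :=
        State.apply_some (State.satisfies_none _)
      have h2 : C.stored.init.apply (C.option 2) = C.planState :=
        State.apply_some (State.satisfies_some.2 rfl)
      refine ⟨State.satisfies_none _, ?_⟩
      rw [h0]
      simp only [hmid, List.map_append, List.append_assoc, List.map_cons, List.cons_append,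
        State.applicable_append]
      refine ⟨ha₁, ?_⟩
      rw [hr₁, hJ]
      refine ⟨State.satisfies_some.2 rfl, ?_⟩
      rw [h2]
      simp only [State.applicable_append, hr₂]
      refine ⟨ha₂, hrep.1, ?_⟩
      rw [hrep.2]
      exact ⟨hfin, trivial⟩
    have hWlen : (0 :: (mid ++ [1])).length = M + 3 := by simp [hmidlen]
    -- The default `0` concerns only slots behind `M + 2`, which are not constrained.
    refine ⟨fun t => (0 :: (mid ++ [1]))[t]?.getD 0, rfl, ?_, ?_, ?_, ?_⟩
    · simp [hmidlen]
    · intro t ht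
      have ht' : t < mid.length := by omega
      simpa [List.getElem?_append_left ht', ht'] using hmidmem _ (List.getElem_mem ht')
    · refine ⟨w₁.length, by simp at hl₁; omega, ?_⟩
      have : w₁.length < mid.length := by simp [hmid]
      simp only [List.getElem?_cons_succ, List.getElem?_append_left this]
      simp [hmid]
    · rw [satisfies_iff rfl]
      intro t ht
      rw [stateAt_getD (by omega)]
      have := happ.satisfies (t := t) (by simp [hmidlen]; omega)
      rw [List.map_take]
      have h1 : t < (0 :: (mid ++ [1])).length := by omega
      simpa only [List.getElem?_eq_getElem h1, Option.getD_some, List.getElem_map] using this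
  · rintro ⟨o, ho⟩
    have hsat := (satisfies_iff ho.first _).1 ho.pre
    obtain ⟨t, ht, h2⟩ := ho.exists_two
    rcases glue_of_timeline ho.first ho.middle hsat le_rfl with ⟨-, hn⟩ |
      ⟨g₁, g₂, hg, hlen, hrun, hrun₂⟩
    · exact absurd h2 (hn t (by omega))
    · refine ⟨g₁ ++ g₂, hg, by simp; omega, g₁.length, by simp, ⟨?_, ?_⟩, by simpa using hrun⟩
      · intro a ha
        simp only [List.take_left, List.drop_left, List.mem_append] at ha
        rcases ha with (ha | ha) | ha
        · exact C.glueActs_subset a (hg a (by simp [ha]))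
        · rw [← C.acts_eq]; exact C.plan_isSolution.1 a ha
        · exact C.glueActs_subset a (hg a (by simp [ha]))
      · simp only [List.take_left, List.drop_left, State.run_append, hrun]
        have := hsat (M + 2) le_rfl
        rw [ho.last] at this
        exact hrun₂ ▸ this
end

/-! ### Case modification belongs to W[2] -/

instance : DataEnc CaseModInstance := ⟨encCaseMod⟩

section
variable {γ : Type} [DataEnc γ]

theorem PolyTime.entryKey {p : γ → List (Option ℕ)} {v : γ → ℕ} (hp : PolyTime p)
    (hv : PolyTime v) : PolyTime fun x => entryKey (p x) (v x) :=
  ((hp.getElem? hv).optionGetD (.const none)).optionElim (f := fun _ x => x + 1) (.const 0)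
    PolyTime.id.snd.succ

theorem PolyTime.preKey {O : γ → List (List (Option ℕ) × List (Option ℕ))} {a v : γ → ℕ}
    (hO : PolyTime O) (ha : PolyTime a) (hv : PolyTime v) :
    PolyTime fun x => preKey (O x) (a x) (v x) :=
  ((hO.getElem? ha).optionGetD (.const ([], []))).fst.entryKey hv

theorem PolyTime.postKey {O : γ → List (List (Option ℕ) × List (Option ℕ))} {a v : γ → ℕ}
    (hO : PolyTime O) (ha : PolyTime a) (hv : PolyTime v) :
    PolyTime fun x => postKey (O x) (a x) (v x) :=
  ((hO.getElem? ha).optionGetD (.const ([], []))).snd.entryKey hv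

theorem PolyTime.singleton {α : Type} [DataEnc α] {f : γ → α} (hf : PolyTime f) :
    PolyTime fun x => [f x] := hf.cons (.const [])

theorem PolyTime.literal {m n : γ → ℕ} (b : Bool) (hm : PolyTime m) (hn : PolyTime n) :
    PolyTime fun x => (Nat.pair (m x) (n x), b) := (hm.natPair hn).pair (.const b)

theorem PolyTime.timelineCNF {n L M : γ → ℕ} {O : γ → List (List (Option ℕ) × List (Option ℕ))}
    (hn : PolyTime n) (hL : PolyTime L) (hM : PolyTime M) (hO : PolyTime O) :
    PolyTime fun x => timelineCNF (n x) (L x) (M x) (PlanReuse.preKey (O x))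
      (PlanReuse.postKey (O x)) := by
  unfold PlanReuse.timelineCNF
  refine .append (.cons (.const _) (.cons (.singleton (.literal _ (hM.add (.const 2)) (.const 1)))
    (.singleton (.map hM.succ.range (.literal _ PolyTime.id.snd.succ (.const 2)))))) (.append ?_ ?_)
  · exact .map hM.succ.range (.map ((hL.comp PolyTime.id.fst).sub (.const 2)).range
      (.literal _ PolyTime.id.fst.snd.succ PolyTime.id.snd.succ.succ))
  · refine .flatMap (hM.add (.const 3)).range ?_
    refine .flatMap PolyTime.id.snd.range ?_
    refine .flatMap (hL.comp PolyTime.id.fst.fst).range ?_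
    refine .flatMap (hL.comp PolyTime.id.fst.fst.fst).range ?_
    refine .map ?_ (.cons ?_ (.cons ?_ ?_))
    · refine .filter (.range (.comp hn PolyTime.id.fst.fst.fst.fst)) ?_
      have ha := (hO.comp PolyTime.id.fst.fst.fst.fst.fst).preKey
        (PolyTime.id (α := ((((γ × ℕ) × ℕ) × ℕ) × ℕ) × ℕ)).fst.fst.snd PolyTime.id.snd
      have hb := (hO.comp PolyTime.id.fst.fst.fst.fst.fst).postKey
        (PolyTime.id (α := ((((γ × ℕ) × ℕ) × ℕ) × ℕ) × ℕ)).fst.snd PolyTime.id.snd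
      exact (ha.decide_eq (.const 0)).not.and ((hb.decide_eq (.const 0)).not.and
        (ha.decide_eq hb).not)
    · exact .literal _ PolyTime.id.fst.fst.fst.fst.snd PolyTime.id.fst.fst.snd
    · exact .literal _ PolyTime.id.fst.fst.fst.snd PolyTime.id.fst.snd
    · refine .flatMap (.filter PolyTime.id.fst.fst.fst.fst.snd.range ?_) ?_
      rotate_left
      refine .map (.filter (hL.comp PolyTime.id.fst.fst.fst.fst.fst.fst).range ?_) ?_
      rotate_left 2
      · exact .decide_lt PolyTime.id.fst.fst.fst.fst.snd PolyTime.id.snd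
      · exact .decide_eq ((hO.comp PolyTime.id.fst.fst.fst.fst.fst.fst.fst).postKey
          PolyTime.id.snd PolyTime.id.fst.fst.snd)
          ((hO.comp PolyTime.id.fst.fst.fst.fst.fst.fst.fst).preKey
          PolyTime.id.fst.fst.fst.fst.snd PolyTime.id.fst.fst.snd)
      · exact .literal _ PolyTime.id.fst.snd PolyTime.id.snd
end

/-! ### Executing plans on states given as lists. -/

/-- A state as a list. -/
def rawState {X : VarSystem} (s : State X) : List ℕ := List.ofFn fun v => (s v).val

/-- The effect of an action on a state that is given as a list. -/
def rawApply (s : List ℕ) (a : List (Option ℕ) × List (Option ℕ)) : List ℕ :=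
  if (List.range s.length).all (fun v =>
    !(!decide (entryKey a.1 v = 0) && !decide (entryKey a.1 v = s[v]?.getD 0 + 1))) = true
  then (List.range s.length).map fun v => (a.2[v]?.getD none).getD (s[v]?.getD 0)
  else s

theorem rawApply_rawState {X : VarSystem} (s : State X) (a : Act X) :
    rawApply (rawState s) (rawAct a) = rawState (s.apply a) := by
  have hget (v : Fin X.num) : (rawState s)[v.val]?.getD 0 = (s v).val := by simp [rawState]
  have hlen : (rawState s).length = X.num := by simp [rawState]
  have hent (v : Fin X.num) : entryKey (rawAct a).1 v = (a.pre v).elim 0 fun x => x.val + 1 :=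
    entryKey_rawPartial a.pre v
  have hc : ((List.range (rawState s).length).all fun v =>
      !(!decide (entryKey (rawAct a).1 v = 0) &&
        !decide (entryKey (rawAct a).1 v = (rawState s)[v]?.getD 0 + 1))) = true ↔
      s.Satisfies a.pre := by
    simp only [hlen, List.all_eq_true, List.mem_range, Bool.not_and, Bool.not_not,
      Bool.or_eq_true, decide_eq_true_eq]
    constructor
    · intro h v x hx
      have := h v v.isLt
      rw [hget, hent, hx] at this
      exact Fin.ext (by simpa [eq_comm] using this)
    · intro h v hv
      have h1 := hget ⟨v, hv⟩
      have h2 := hent ⟨v, hv⟩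
      simp only at h1 h2
      rw [h1, h2]
      cases hx : a.pre ⟨v, hv⟩ with
      | none => exact .inl rfl
      | some x => rw [h _ _ hx]; exact .inr rfl
  unfold rawApply State.apply
  by_cases h : s.Satisfies a.pre
  · rw [if_pos (hc.2 h), if_pos h]
    apply List.ext_getElem
    · simp [rawState]
    · intro v h1 h2
      have hv : v < X.num := by simpa [rawState] using h2
      have hp : (rawAct a).2[v]?.getD none = (a.post ⟨v, hv⟩).map Fin.val := by
        simp [rawAct, rawPartial, hv]
      rw [List.getElem_map, List.getElem_range, hp, hget ⟨v, hv⟩]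
      simp only [rawState, List.getElem_ofFn]
      cases a.post ⟨v, hv⟩ <;> rfl
  · rw [if_neg (fun h' => h (hc.1 h')), if_neg h]

theorem foldl_rawApply {X : VarSystem} (s : State X) (p : List (Act X)) :
    (p.map rawAct).foldl rawApply (rawState s) = rawState (State.run s p) := by
  induction p generalizing s with
  | nil => rfl
  | cons a p ih => rw [List.map_cons, List.foldl_cons, rawApply_rawState, ih]; rfl

/-- Numbers are unary, so smaller entries give smaller trees. Every state is thereby bounded in size
by the list of domain sizes. -/
theorem sz_ofFn_le {n : ℕ} {f g : Fin n → ℕ} (h : ∀ v, f v ≤ g v) :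
    sz (List.ofFn f) ≤ sz (List.ofFn g) := by
  induction n with
  | zero => simp
  | succ n ih =>
    have h1 := ih (fun v => h v.succ)
    have h2 := h 0
    rw [List.ofFn_succ, List.ofFn_succ, sz_cons, sz_cons, sz_nat, sz_nat]
    omega

/-- The domain sizes as a list. -/
def rawDoms (X : VarSystem) : List ℕ := List.ofFn X.dom

theorem enc_rawState {X : VarSystem} (s : State X) : enc (rawState s) = encState s := by
  show Data.ofList _ = _
  rw [rawState, List.map_ofFn]
  rfl

theorem enc_rawDoms (X : VarSystem) : enc (rawDoms X) = encVarSystem X := by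
  show Data.ofList _ = _
  rw [rawDoms, List.map_ofFn]
  rfl

theorem enc_rawPartial {X : VarSystem} (p : PartialState X) :
    enc (rawPartial p) = encPartialState p := by
  show Data.ofList _ = _
  rw [rawPartial, List.map_ofFn, encPartialState]
  congr 2
  funext v
  show Data.ofOption _ = _
  rw [Option.map_map]
  rfl

theorem enc_rawAct {X : VarSystem} (a : Act X) : enc (rawAct a) = encAct a := by
  show Data.cons _ _ = _
  rw [encAct, ← enc_rawPartial, ← enc_rawPartial]
  rfl

theorem enc_rawActs {X : VarSystem} (l : List (Act X)) : enc (l.map rawAct) = encActs l := by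
  show Data.ofList _ = _
  rw [encActs, List.map_map]
  congr 2
  funext a
  exact enc_rawAct a

/-- An instance of case modification as a tuple of lists. -/
def rawInstance (C : CaseModInstance) : List ℕ × List ℕ × List (Option ℕ) ×
    List (List (Option ℕ) × List (Option ℕ)) × List ℕ × List (Option ℕ) ×
    List (List (Option ℕ) × List (Option ℕ)) × List (List (Option ℕ) × List (Option ℕ)) × Unit :=
  (rawDoms C.X, rawState C.target.init, rawPartial C.target.goal, C.target.acts.map rawAct,
    rawState C.stored.init, rawPartial C.stored.goal, C.plan.map rawAct, C.glueActs.map rawAct, ())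

/-- The dependent types leave no trace in the trees, so instances can be processed as nested lists.
The final `()` of the tuple is the `nil` that ends the encoding list. -/
theorem enc_rawInstance (C : CaseModInstance) : enc (rawInstance C) = encCaseMod C := by
  rw [encCaseMod, ← enc_rawState, ← enc_rawState, ← enc_rawDoms, ← enc_rawPartial,
    ← enc_rawPartial, ← enc_rawActs, ← enc_rawActs, ← enc_rawActs]
  rfl

section
variable {γ : Type} [DataEnc γ] {f : γ → CaseModInstance}

theorem PolyTime.rawInstance (hf : PolyTime f) : PolyTime fun x => rawInstance (f x) :=
  hf.of_enc_eq fun _ => enc_rawInstance _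

theorem PolyTime.rawApply {s : γ → List ℕ} {a : γ → List (Option ℕ) × List (Option ℕ)}
    (hs : PolyTime s) (ha : PolyTime a) : PolyTime fun x => rawApply (s x) (a x) := by
  unfold PlanReuse.rawApply
  have hk := (ha.comp PolyTime.id.fst).fst.entryKey (PolyTime.id (α := γ × ℕ)).snd
  have hg := ((hs.comp PolyTime.id.fst).getElem? (PolyTime.id (α := γ × ℕ)).snd).optionGetD
    (.const 0)
  refine .ite (hs.length.range.all ?_) (hs.length.range.map ?_) hs
  · exact ((hk.decide_eq (.const 0)).not.and (hk.decide_eq hg.succ).not).not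
  · exact (((ha.comp PolyTime.id.fst).snd.getElem? PolyTime.id.snd).optionGetD
      (.const none)).optionGetD hg

/-- The stored plan is part of the input and can be simulated. The intermediate results are states,
so the domain sizes, also part of the input, bound them throughout the fold. -/
theorem PolyTime.planState (hf : PolyTime f) : PolyTime fun x => rawState (f x).planState := by
  refine PolyTime.comp (g := fun C : CaseModInstance => rawState C.planState) ?_ hf
  have hr := PolyTime.rawInstance PolyTime.id
  obtain ⟨D, hD⟩ := hr.fst.sz_le
  refine (PolyTime.foldl (step := fun _ s a => PlanReuse.rawApply s a)
    hr.snd.snd.snd.snd.snd.snd.fst hr.snd.snd.snd.snd.fst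
    (PolyTime.id.snd.fst.rawApply PolyTime.id.snd.snd) D fun C l₁ l₂ h => ?_).of_eq
    fun C => (foldl_rawApply _ _).symm
  obtain ⟨p, q, -, rfl, -⟩ := List.map_eq_append_iff.1
    (show C.plan.map rawAct = l₁ ++ l₂ from h)
  show sz ((p.map rawAct).foldl PlanReuse.rawApply (rawState C.stored.init)) ≤ _
  rw [foldl_rawApply]
  exact (sz_ofFn_le fun v => (Fin.isLt _).le).trans (hD C)

theorem PolyTime.rawOptions (hf : PolyTime f) : PolyTime fun x => (f x).rawOptions := by
  have hr := hf.rawInstance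
  have hnone : PolyTime fun x => (rawDoms (f x).X).map fun _ => (none : Option ℕ) :=
    hr.fst.map (.const none)
  have hsome {s : γ → List ℕ} (hs : PolyTime s) : PolyTime fun x => (s x).map Option.some :=
    hs.map (f := fun _ => Option.some) (.some PolyTime.id.snd)
  refine (PolyTime.cons (hnone.pair (hsome hr.snd.fst)) (.cons (hr.snd.snd.fst.pair hnone)
    (.cons ((hsome hr.snd.snd.snd.snd.fst).pair (hsome hf.planState)) (.cons (hnone.pair hnone)
      hr.snd.snd.snd.snd.snd.snd.snd.fst)))).of_eq fun x => ?_
  have h0 : (rawDoms (f x).X).map (fun _ => (none : Option ℕ)) =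
      rawPartial (X := (f x).X) fun _ => none := by
    simp only [rawDoms, rawPartial, List.map_ofFn]
    rfl
  have h1 (s : State (f x).X) : (rawState s).map Option.some = rawPartial fun v => Option.some (s v) := by
    simp only [rawState, rawPartial, List.map_ofFn]
    rfl
  simp only [PlanReuse.rawInstance, h0, h1]
  rfl
end

theorem lCaseMod_mem_W2 : lCaseMod ∈ W2 := by
  refine FptReducible.of_runs (P := lCaseMod) (Q := weightedCNFSat)
    (fun x => (timelineCNF x.1.X.num x.1.options.length x.2 (preKey x.1.rawOptions)
      (postKey x.1.rawOptions), x.2 + 3)) (fun k => k + 3) ?_ ?_ ?_ (fun _ _ => le_rfl)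
  · have hC : PolyTime fun x : CaseModInstance × ℕ => x.1 := PolyTime.id.fst
    have hM : PolyTime fun x : CaseModInstance × ℕ => x.2 := PolyTime.id.snd
    exact (PolyTime.timelineCNF (hC.rawInstance.fst.length.of_eq fun x => by
        simp [rawInstance, rawDoms]) (hC.rawOptions.length.of_eq fun x => by
          simp [CaseModInstance.rawOptions]) hM hC.rawOptions).pair (hM.add (.const 3))
  · exact (Primrec.nat_add.comp Primrec.id (Primrec.const 3)).to_comp
  · intro C M
    refine (solvable_iff_timeline M).trans (timelineCNF_iff ?_ ?_ ?_).symm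
    · simp [CaseModInstance.options]
    · intro v hv
      exact preKey_rawOptions 0 ⟨v, hv⟩
    · intro v hv
      rw [postKey_rawOptions 0 ⟨v, hv⟩]
      exact Nat.succ_ne_zero _

/-! ### W[2]-hardness of case modification -/

/-- An upper bound for the variables of a formula. -/
def CNF.bound (F : CNF) : ℕ := (F.flatten.map Prod.fst).sum

/-- The positions of the variables of a formula, and a final position behind them. -/
def CNF.positions (F : CNF) : List ℕ := (F.flatten.map fun l => l.1 + 1) ++ [F.bound + 2]

/-- The clause has a true literal at position `y` or a negative literal strictly between `x` and
`y`. -/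
def gapSat (x y : ℕ) (C : Clause) : Bool :=
  C.any fun l => if l.2 = true then decide (l.1 + 1 = y)
    else decide (x < l.1 + 1) && decide (l.1 + 1 < y)

theorem gapSat_iff {x y : ℕ} {C : Clause} : gapSat x y C = true ↔ ∃ l ∈ C,
    (l.2 = true ∧ l.1 + 1 = y) ∨ (l.2 = false ∧ x < l.1 + 1 ∧ l.1 + 1 < y) := by
  simp only [gapSat, List.any_eq_true]
  refine exists_congr fun l => and_congr_right fun _ => ?_
  cases l.2 <;> simp

theorem CNF.le_bound {F : CNF} {v : ℕ} (h : v ∈ F.vars) : v ≤ F.bound :=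
  List.le_sum_of_mem (List.mem_toFinset.1 h)

theorem CNF.mem_positions {F : CNF} {y : ℕ} :
    y ∈ F.positions ↔ (∃ v ∈ F.vars, v + 1 = y) ∨ y = F.bound + 2 := by
  simp only [CNF.positions, CNF.vars, List.mem_append, List.mem_map, List.mem_toFinset,
    List.mem_singleton, exists_exists_and_eq_and]

theorem CNF.le_of_mem_positions {F : CNF} {y : ℕ} (h : y ∈ F.positions) : y ≤ F.bound + 2 := by
  rcases CNF.mem_positions.1 h with ⟨v, hv, rfl⟩ | rfl
  · have := CNF.le_bound hv; omega
  · rfl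

/-- A step of the selection: `y` is the next selected position after `x`, and `j` positions have been
selected before. -/
def rawStep (F : CNF) (j x y : ℕ) : List (Option ℕ) × List (Option ℕ) :=
  (some x :: some j :: F.map fun _ => none,
    some y :: some (j + 1) :: F.map fun C => if gapSat x y C = true then some 1 else none)

/-- All steps of the selection of `k` variables. -/
def rawSteps (F : CNF) (k : ℕ) : List (List (Option ℕ) × List (Option ℕ)) :=
  (List.range (k + 1)).flatMap fun j => (List.range (F.bound + 3)).flatMap fun x =>
    (F.positions.filter fun y => decide (x < y)).map fun y => rawStep F j x y

theorem mem_rawSteps {F : CNF} {k : ℕ} {r : List (Option ℕ) × List (Option ℕ)} :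
    r ∈ rawSteps F k ↔ ∃ j < k + 1, ∃ x < F.bound + 3, ∃ y ∈ F.positions, x < y ∧
      rawStep F j x y = r := by
  simp only [rawSteps, List.mem_flatMap, List.mem_range, List.mem_map, List.mem_filter,
    decide_eq_true_eq, and_assoc]

/-- Variables for the current position, for the number of selected positions, and for every
clause. -/
def selectionSystem (F : CNF) (k : ℕ) : VarSystem := ⟨F.length + 2, fun _ => F.bound + k + 2 + 1⟩

/-! ### The selection of variables as a planning instance. -/

section
variable {F : CNF} {k : ℕ}

/-- The partial state with given entries. -/
def toPartial (l : List (Option ℕ)) : PartialState (selectionSystem F k) :=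
  fun v => (l[v.val]?.getD none).map (Fin.ofNat (F.bound + k + 2 + 1))

/-- The action with given entries. -/
def toAct (r : List (Option ℕ) × List (Option ℕ)) : Act (selectionSystem F k) :=
  ⟨toPartial r.1, toPartial r.2⟩

/-- `Fin.ofNat` reduces modulo the domain size; below that size nothing wraps around. -/
theorem rawPartial_toPartial {l : List (Option ℕ)} (hlen : l.length = F.length + 2)
    (hl : ∀ x, some x ∈ l → x < F.bound + k + 3) :
    rawPartial (toPartial l : PartialState (selectionSystem F k)) = l := by
  apply List.ext_getElem
  · simp [rawPartial, selectionSystem, hlen]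
  · intro v h1 h2
    simp only [rawPartial, toPartial, List.getElem_ofFn, List.getElem?_eq_getElem h2,
      Option.getD_some]
    cases hx : l[v] with
    | none => rfl
    | some x =>
      have := hl x (hx ▸ List.getElem_mem h2)
      exact congrArg some (Nat.mod_eq_of_lt this)

theorem rawAct_toAct {r : List (Option ℕ) × List (Option ℕ)} (hr : r ∈ rawSteps F k) :
    rawAct (toAct r : Act (selectionSystem F k)) = r := by
  obtain ⟨j, hj, x, hx, y, hy, -, rfl⟩ := mem_rawSteps.1 hr
  have := CNF.le_of_mem_positions hy
  refine Prod.ext (rawPartial_toPartial (by simp [rawStep]) ?_)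
    (rawPartial_toPartial (by simp [rawStep]) ?_)
  · intro z hz
    simp [rawStep] at hz
    omega
  · intro z hz
    simp [rawStep] at hz
    omega

/-- The selected position. -/
def pos (s : State (selectionSystem F k)) : ℕ := (s ⟨0, Nat.succ_pos _⟩).val

/-- The number of selected positions. -/
def cnt (s : State (selectionSystem F k)) : ℕ := (s ⟨1, Nat.succ_lt_succ (Nat.succ_pos _)⟩).val

/-- The mark of a clause, `1` if the clause is known to be satisfied. -/
def mark (s : State (selectionSystem F k)) (i : ℕ) (hi : i < F.length) : ℕ :=
  (s ⟨i + 2, Nat.add_lt_add_right hi 2⟩).val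

theorem forall_var {p : Fin (selectionSystem F k).num → Prop} : (∀ v, p v) ↔
    p ⟨0, Nat.succ_pos _⟩ ∧ p ⟨1, Nat.succ_lt_succ (Nat.succ_pos _)⟩ ∧
      ∀ i (hi : i < F.length), p ⟨i + 2, Nat.add_lt_add_right hi 2⟩ := by
  constructor
  · exact fun h => ⟨h _, h _, fun _ _ => h _⟩
  · rintro ⟨h0, h1, h⟩ ⟨v, hv⟩
    match v, hv with
    | 0, _ => exact h0
    | 1, _ => exact h1
    | i + 2, hv => exact h i (Nat.lt_of_add_lt_add_right hv)

theorem satisfies_at {s : State (selectionSystem F k)} {l : List (Option ℕ)}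
    {v : Fin (selectionSystem F k).num} {o : Option ℕ} (ho : l[v.val]? = some o)
    (hx : ∀ x, o = some x → x < F.bound + k + 3) :
    (∀ x, (toPartial l : PartialState (selectionSystem F k)) v = some x → s v = x) ↔
      ∀ x, o = some x → (s v).val = x := by
  simp only [toPartial, ho, Option.getD_some]
  cases o with
  | none => exact ⟨fun _ _ h => (Option.some_ne_none _ h.symm).elim,
      fun _ _ h => (Option.some_ne_none _ h.symm).elim⟩
  | some x =>
    have hm : (Fin.ofNat (F.bound + k + 2 + 1) x).val = x := Nat.mod_eq_of_lt (hx x rfl)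
    constructor
    · rintro h z hz
      cases hz
      rw [h _ rfl, hm]
    · rintro h z hz
      cases hz
      exact Fin.ext ((h _ rfl).trans hm.symm)

theorem satisfies_toPartial {s : State (selectionSystem F k)} {x j : ℕ}
    {f : Clause → Option ℕ} (hx : x < F.bound + k + 3) (hj : j < F.bound + k + 3)
    (hf : ∀ C, ∀ z, f C = some z → z < F.bound + k + 3) :
    s.Satisfies (toPartial (some x :: some j :: F.map f)) ↔ pos s = x ∧ cnt s = j ∧
      ∀ i (hi : i < F.length), ∀ z, f F[i] = some z → mark s i hi = z := by
  rw [State.Satisfies, forall_var]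
  refine and_congr ?_ (and_congr ?_ (forall₂_congr fun i hi => ?_))
  · rw [satisfies_at (o := some x) (by simp) (by simpa using hx)]
    simp [pos]
  · rw [satisfies_at (o := some j) (by simp) (by simpa using hj)]
    simp [cnt]
  · rw [satisfies_at (o := f F[i]) (by simp [hi]) (hf _)]
    rfl

theorem apply_at {s : State (selectionSystem F k)} {r : List (Option ℕ) × List (Option ℕ)}
    {v : Fin (selectionSystem F k).num} {o : Option ℕ} (ho : r.2[v.val]? = some o)
    (hx : ∀ x, o = some x → x < F.bound + k + 3)
    (hs : s.Satisfies (toPartial r.1)) : (s.apply (toAct r) v).val = o.getD (s v) := by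
  rw [State.apply, if_pos (show s.Satisfies (toAct r).pre from hs)]
  simp only [toAct, toPartial, ho, Option.getD_some]
  cases o with
  | none => rfl
  | some x => exact Nat.mod_eq_of_lt (hx x rfl)

theorem apply_rawStep {s : State (selectionSystem F k)} {j x y : ℕ} (hj : j < k + 1)
    (hy : y ∈ F.positions) (hpos : pos s = x) (hcnt : cnt s = j) :
    pos (s.apply (toAct (rawStep F j x y))) = y ∧ cnt (s.apply (toAct (rawStep F j x y))) = j + 1 ∧
    ∀ i hi, mark (s.apply (toAct (rawStep F j x y))) i hi =
      if gapSat x y F[i] = true then 1 else mark s i hi := by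
  have hy' := CNF.le_of_mem_positions hy
  have hx : x < F.bound + k + 3 := hpos ▸ Fin.isLt _
  have hs : s.Satisfies (toPartial (rawStep F j x y).1) :=
    (satisfies_toPartial hx (by omega) (by simp)).2 ⟨hpos, hcnt, by simp⟩
  refine ⟨?_, ?_, fun i hi => ?_⟩
  · exact apply_at (o := some y) rfl (by simp; omega) hs
  · exact apply_at (o := some (j + 1)) rfl (by simp; omega) hs
  · refine (apply_at (o := if gapSat x y F[i] = true then some 1 else none)
      (by simp [rawStep, hi]) (fun z hz => ?_) hs).trans ?_
    · split at hz
      · simp only [Option.some.injEq] at hz; omega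
      · simp at hz
    · by_cases hg : gapSat x y F[i] = true
      · simp [hg]
      · simp only [hg]; rfl

theorem apply_rawStep_of_not {s : State (selectionSystem F k)} {j x y : ℕ} (hj : j < k + 1)
    (hx : x < F.bound + 3) (h : ¬(pos s = x ∧ cnt s = j)) :
    s.apply (toAct (rawStep F j x y)) = s := by
  rw [State.apply, if_neg]
  intro hs
  have := (satisfies_toPartial (by omega) (by omega) (by simp)).1 hs
  exact h ⟨this.1, this.2.1⟩

variable (F k) in
/-- The state before the selection. -/
def selectionInit : State (selectionSystem F k) := fun _ => Fin.ofNat (F.bound + k + 2 + 1) 0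

variable (F k) in
/-- The entries of the goal: the last position is reached with `k + 1` steps, and all clauses are
satisfied. -/
def rawGoal : List (Option ℕ) := some (F.bound + 2) :: some (k + 1) :: F.map fun _ => some 1

variable (F k) in
/-- Selection of `k` variables as a case modification with an empty stored plan. -/
def selectionInstance : CaseModInstance where
  X := selectionSystem F k
  target := ⟨selectionInit F k, toPartial (rawGoal F k), (rawSteps F k).map toAct⟩
  stored := ⟨selectionInit F k, fun _ => none, (rawSteps F k).map toAct⟩
  acts_eq := rfl
  plan := []
  plan_isSolution := ⟨by simp, State.satisfies_none _⟩
  glueActs := (rawSteps F k).map toAct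
  glueActs_subset := fun _ h => h

/-! ### Correctness of the selection. -/

/-- If exactly the positions in `T` are selected among those up to `x`, then the clause has a true
literal at one of them. -/
def SatUpTo (T : Finset ℕ) (x : ℕ) (C : Clause) : Prop :=
  ∃ l ∈ C, (l.2 = true ∧ l.1 + 1 ∈ T) ∨ (l.2 = false ∧ l.1 + 1 ∉ T ∧ l.1 + 1 ≤ x)

/-- The state `s` may have arisen from the selection of the positions in `T`. -/
structure Selected (s : State (selectionSystem F k)) (T : Finset ℕ) : Prop where
  mem : ∀ y ∈ T, y ∈ F.positions
  card : T.card = cnt s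
  le : ∀ y ∈ T, y ≤ pos s
  pos_mem : pos s ≠ 0 → pos s ∈ T
  sat : ∀ i hi, mark s i hi = 1 → SatUpTo T (pos s) F[i]

theorem Selected.init : Selected (selectionInit F k) ∅ where
  mem := by simp
  card := rfl
  le := by simp
  pos_mem h := absurd rfl h
  sat i hi h := by simp [mark, selectionInit] at h

/-- An applicable step adds `y` to `T`. Since `T` lies below or at `x < y`, positions strictly
between `x` and `y` are and remain unselected, which justifies the new marks; old marks survive
because `y` differs from every position up to `x`. -/
theorem Selected.apply {s : State (selectionSystem F k)} {T : Finset ℕ} (h : Selected s T)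
    {a : Act (selectionSystem F k)} (ha : a ∈ (rawSteps F k).map toAct) :
    ∃ T, Selected (s.apply a) T := by
  obtain ⟨r, hr, rfl⟩ := List.mem_map.1 ha
  obtain ⟨j, hj, x, hx, y, hy, hxy, rfl⟩ := mem_rawSteps.1 hr
  by_cases hs : pos s = x ∧ cnt s = j
  swap
  · exact ⟨T, by rwa [apply_rawStep_of_not hj hx hs]⟩
  obtain ⟨h1, h2, h3⟩ := apply_rawStep hj hy hs.1 hs.2
  have hle : ∀ z ∈ T, z ≤ x := fun z hz => hs.1 ▸ h.le z hz
  have hyT : y ∉ T := fun hyT => absurd (hle y hyT) (by omega)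
  refine ⟨insert y T, ⟨?_, ?_, ?_, ?_, ?_⟩⟩
  · intro z hz
    rcases Finset.mem_insert.1 hz with rfl | hz
    · exact hy
    · exact h.mem z hz
  · rw [Finset.card_insert_of_notMem hyT, h.card, h2, hs.2]
  · intro z hz
    rw [h1]
    rcases Finset.mem_insert.1 hz with rfl | hz
    · rfl
    · have := hle z hz; omega
  · rw [h1]
    exact fun _ => Finset.mem_insert_self _ _
  · intro i hi hm
    rw [h3] at hm
    rw [h1]
    by_cases hg : gapSat x y F[i] = true
    · obtain ⟨l, hl, ⟨hb, rfl⟩ | ⟨hb, hlt, hgt⟩⟩ := gapSat_iff.1 hg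
      · exact ⟨l, hl, .inl ⟨hb, Finset.mem_insert_self _ _⟩⟩
      · refine ⟨l, hl, .inr ⟨hb, fun hm => ?_, hgt.le⟩⟩
        rcases Finset.mem_insert.1 hm with hm | hm
        · omega
        · have := hle _ hm; omega
    · rw [if_neg hg] at hm
      obtain ⟨l, hl, ⟨hb, hT⟩ | ⟨hb, hT, hlx⟩⟩ := h.sat i hi hm
      · exact ⟨l, hl, .inl ⟨hb, Finset.mem_insert_of_mem hT⟩⟩
      · rw [hs.1] at hlx
        refine ⟨l, hl, .inr ⟨hb, fun hm => ?_, by omega⟩⟩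
        rcases Finset.mem_insert.1 hm with hm | hm
        · omega
        · exact hT hm

theorem Selected.run {s : State (selectionSystem F k)} {T : Finset ℕ} (h : Selected s T)
    {p : List (Act (selectionSystem F k))} (hp : ∀ a ∈ p, a ∈ (rawSteps F k).map toAct) :
    ∃ T, Selected (State.run s p) T := by
  induction p generalizing s T with
  | nil => exact ⟨T, h⟩
  | cons a p ih =>
    obtain ⟨T', h'⟩ := h.apply (hp a (by simp))
    exact ih h' fun b hb => hp b (by simp [hb])

theorem satisfies_rawGoal {s : State (selectionSystem F k)} :
    s.Satisfies (toPartial (rawGoal F k)) ↔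
      pos s = F.bound + 2 ∧ cnt s = k + 1 ∧ ∀ i (hi : i < F.length), mark s i hi = 1 :=
  (satisfies_toPartial (by omega) (by omega) (fun _ z hz => by
    simp only [Option.some.injEq] at hz; omega)).trans (by simp)

/-- The positions are selected in increasing order, by induction on adding a new maximum `y`. A
clause satisfied up to `y` has a witness that was valid before, is `y` itself, or lies in the gap
just skipped. -/
theorem exists_plan (T : Finset ℕ) (hT : ∀ y ∈ T, y ∈ F.positions) (hcard : T.card ≤ k + 1) :
    ∃ p : List (Act (selectionSystem F k)), (∀ a ∈ p, a ∈ (rawSteps F k).map toAct) ∧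
      p.length = T.card ∧ cnt (State.run (selectionInit F k) p) = T.card ∧
      (∀ y ∈ T, y ≤ pos (State.run (selectionInit F k) p)) ∧
      (pos (State.run (selectionInit F k) p) ≠ 0 → pos (State.run (selectionInit F k) p) ∈ T) ∧
      ∀ i hi, SatUpTo T (pos (State.run (selectionInit F k) p)) F[i] →
        mark (State.run (selectionInit F k) p) i hi = 1 := by
  induction T using Finset.induction_on_max with
  | empty =>
    refine ⟨[], by simp, rfl, rfl, by simp, fun h => absurd rfl h, ?_⟩
    rintro i hi ⟨l, -, ⟨-, h⟩ | ⟨-, -, h⟩⟩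
    · simp at h
    · exact absurd h (Nat.not_succ_le_zero _)
  | insert y T hlt ih =>
    have hyT : y ∉ T := fun h => lt_irrefl _ (hlt y h)
    rw [Finset.card_insert_of_notMem hyT] at hcard
    obtain ⟨p, hp, hlen, hcnt, hle, hpos, hsat⟩ :=
      ih (fun z hz => hT z (Finset.mem_insert_of_mem hz)) (by omega)
    set s := State.run (selectionInit F k) p with hs
    have hy := hT y (Finset.mem_insert_self _ _)
    have hyb := CNF.le_of_mem_positions hy
    -- The start is position `0`, while all positions in `F.positions` are positive: variable `v`
    -- sits at `v + 1`.
    have hxy : pos s < y := by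
      by_cases h0 : pos s = 0
      · rcases CNF.mem_positions.1 hy with ⟨v, -, rfl⟩ | rfl <;> omega
      · exact hlt _ (hpos h0)
    obtain ⟨h1, h2, h3⟩ := apply_rawStep (s := s) (j := cnt s) (x := pos s) (y := y) (by omega)
      hy rfl rfl
    have hrun : State.run (selectionInit F k) (p ++ [toAct (rawStep F (cnt s) (pos s) y)]) =
        s.apply (toAct (rawStep F (cnt s) (pos s) y)) := by
      rw [State.run_append]; rfl
    refine ⟨p ++ [toAct (rawStep F (cnt s) (pos s) y)], ?_, ?_, ?_, ?_, ?_, ?_⟩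
    · intro a ha
      rcases List.mem_append.1 ha with ha | ha
      · exact hp a ha
      · rw [List.mem_singleton.1 ha]
        exact List.mem_map_of_mem (mem_rawSteps.2
          ⟨_, by omega, _, by omega, y, hy, hxy, rfl⟩)
    · rw [Finset.card_insert_of_notMem hyT]
      simp [hlen]
    · rw [hrun, h2, hcnt, Finset.card_insert_of_notMem hyT]
    · intro z hz
      rw [hrun, h1]
      rcases Finset.mem_insert.1 hz with rfl | hz
      · rfl
      · exact (hlt z hz).le
    · rw [hrun, h1]
      exact fun _ => Finset.mem_insert_self _ _
    · rw [hrun, h1]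
      intro i hi hsT
      rw [h3]
      by_cases hg : gapSat (pos s) y F[i] = true
      · rw [if_pos hg]
      rw [if_neg hg]
      apply hsat
      rw [gapSat_iff] at hg
      obtain ⟨l, hl, ⟨hb, hm⟩ | ⟨hb, hm, hly⟩⟩ := hsT
      · rcases Finset.mem_insert.1 hm with hm | hm
        · exact absurd ⟨l, hl, .inl ⟨hb, hm⟩⟩ hg
        · exact ⟨l, hl, .inl ⟨hb, hm⟩⟩
      · rw [Finset.mem_insert, not_or] at hm
        refine ⟨l, hl, .inr ⟨hb, hm.2, ?_⟩⟩
        -- An unselected position behind the previous one, at most `y` and different from `y`, lies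
        -- in the gap, so the step would have marked the clause.
        by_contra hgt
        exact hg ⟨l, hl, .inr ⟨hb, by omega, by omega⟩⟩

/-- Satisfying sets of variables correspond to sets of `k + 1` selected positions: shift by one and
add the final position `F.bound + 2`. As this lies behind all variables, the last jump also accounts
for the negative literals after the last selected variable. -/
theorem selectionInstance_solvable_iff :
    (selectionInstance F k).Solvable (k + 1) ↔
      ∃ S : Finset ℕ, S ⊆ F.vars ∧ S.card = k ∧ F.SatisfiedBy S := by
  constructor
  · rintro ⟨g, -, -, i, -, ⟨hacts, hgoal⟩, -⟩
    obtain ⟨T, hT⟩ := Selected.init.run hacts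
    set s : State (selectionSystem F k) := State.run (selectionInit F k)
      (g.take i ++ (selectionInstance F k).plan ++ g.drop i)
    obtain ⟨h1, h2, h3⟩ := satisfies_rawGoal.1 (show s.Satisfies (toPartial (rawGoal F k)) from hgoal)
    -- The goal position is not the start, so it has been selected; the other `k` elements of `T`
    -- belong to variables.
    have hend : F.bound + 2 ∈ T := h1 ▸ hT.pos_mem (by rw [h1]; omega)
    have himg : (F.vars.filter fun v => v + 1 ∈ T).image (· + 1) = T.erase (F.bound + 2) := by
      ext y
      simp only [Finset.mem_image, Finset.mem_filter, Finset.mem_erase]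
      constructor
      · rintro ⟨v, ⟨hv, hvT⟩, rfl⟩
        have := CNF.le_bound hv
        exact ⟨by omega, hvT⟩
      · rintro ⟨hne, hy⟩
        rcases CNF.mem_positions.1 (hT.mem y hy) with ⟨v, hv, rfl⟩ | rfl
        · exact ⟨v, ⟨hv, hy⟩, rfl⟩
        · exact absurd rfl hne
    refine ⟨F.vars.filter fun v => v + 1 ∈ T, Finset.filter_subset _ _, ?_, ?_⟩
    · rw [← Finset.card_image_of_injective _ (add_left_injective 1), himg,
        Finset.card_erase_of_mem hend, hT.card, h2]
      rfl
    · intro C hC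
      obtain ⟨i, hi, rfl⟩ := List.getElem_of_mem hC
      obtain ⟨l, hl, ⟨hb, hm⟩ | ⟨hb, hm, -⟩⟩ := hT.sat i hi (h3 i hi)
      · refine ⟨l, hl, ?_⟩
        simp only [Finset.mem_filter, hb, hm, and_true, iff_true]
        exact CNF.mem_vars.2 ⟨_, hC, l, hl, rfl⟩
      · exact ⟨l, hl, by simp [hb, hm]⟩
  · rintro ⟨S, hS, hcard, hsat⟩
    have hnot : F.bound + 2 ∉ S.image (· + 1) := by
      intro h
      obtain ⟨v, hv, hv2⟩ := Finset.mem_image.1 h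
      have := CNF.le_bound (hS hv)
      omega
    have hTcard : (insert (F.bound + 2) (S.image (· + 1))).card = k + 1 := by
      rw [Finset.card_insert_of_notMem hnot,
        Finset.card_image_of_injective _ (add_left_injective 1), hcard]
    obtain ⟨p, hp, hlen, hcnt, hle, hpos, hmark⟩ :=
      exists_plan (F := F) (k := k) (insert (F.bound + 2) (S.image (· + 1))) (by
        intro y hy
        rw [CNF.mem_positions]
        rcases Finset.mem_insert.1 hy with rfl | hy
        · exact .inr rfl
        · obtain ⟨v, hv, rfl⟩ := Finset.mem_image.1 hy
          exact .inl ⟨v, hS hv, rfl⟩) hTcard.le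
    have hp1 : pos (State.run (selectionInit F k) p) = F.bound + 2 := by
      have h1 := hle _ (Finset.mem_insert_self _ _)
      rcases Finset.mem_insert.1 (hpos (by omega)) with h | h
      · exact h
      · obtain ⟨v, hv, hv2⟩ := Finset.mem_image.1 h
        have := CNF.le_bound (hS hv)
        omega
    -- All glue follows the empty stored plan, whose initial state is that of the target.
    refine ⟨p, hp, (hlen.trans hTcard).le, 0, Nat.zero_le _, ⟨?_, ?_⟩, rfl⟩
    · intro a ha
      rcases List.mem_append.1 ha with ha | ha
      · exact absurd ha List.not_mem_nil
      · exact hp a ha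
    · show State.Satisfies (State.run (selectionInit F k) p) (toPartial (rawGoal F k))
      refine satisfies_rawGoal.2 ⟨hp1, by rw [hcnt, hTcard], fun i hi => hmark i hi ?_⟩
      obtain ⟨l, hl, hlS⟩ := hsat F[i] (List.getElem_mem hi)
      have hlv : l.1 ≤ F.bound :=
        CNF.le_bound (CNF.mem_vars.2 ⟨_, List.getElem_mem hi, l, hl, rfl⟩)
      refine ⟨l, hl, ?_⟩
      rw [hp1]
      cases hb : l.2 with
      | true =>
        exact .inl ⟨rfl, Finset.mem_insert_of_mem (Finset.mem_image_of_mem _ (hlS.2 hb))⟩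
      | false =>
        refine .inr ⟨rfl, fun hm => ?_, by omega⟩
        rcases Finset.mem_insert.1 hm with hm | hm
        · omega
        · obtain ⟨v, hv, hv2⟩ := Finset.mem_image.1 hm
          obtain rfl : v = l.1 := by simpa using hv2
          rw [hb] at hlS
          exact absurd (hlS.1 hv) (by simp)
end

/-! ### Computing the selection instance in polynomial time. -/

/-- As nested lists the components are explicit and free of dependent types, so the closure
properties of `PolyTime` apply to them. -/
theorem rawInstance_selectionInstance (F : CNF) (k : ℕ) :
    rawInstance (selectionInstance F k) =
      (List.replicate (F.length + 2) (F.bound + k + 3), List.replicate (F.length + 2) 0,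
        rawGoal F k, rawSteps F k, List.replicate (F.length + 2) 0,
        List.replicate (F.length + 2) none, [], rawSteps F k, ()) := by
  have hacts : ((rawSteps F k).map toAct).map (rawAct (X := selectionSystem F k)) = rawSteps F k := by
    rw [List.map_map]
    exact (List.map_congr_left fun r hr => rawAct_toAct hr).trans (List.map_id _)
  have hgoal : rawPartial (toPartial (rawGoal F k) : PartialState (selectionSystem F k)) =
      rawGoal F k := by
    refine rawPartial_toPartial (by simp [rawGoal]) fun x hx => ?_
    simp [rawGoal] at hx
    omega
  have hinit : rawState (selectionInit F k) = List.replicate (F.length + 2) 0 :=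
    List.ofFn_const _ _
  have hnone : rawPartial (X := selectionSystem F k) (fun _ => none) =
      List.replicate (F.length + 2) none := List.ofFn_const _ _
  have hdoms : rawDoms (selectionSystem F k) =
      List.replicate (F.length + 2) (F.bound + k + 3) := List.ofFn_const _ _
  rw [← hdoms, ← hinit, ← hnone]
  simp only [rawInstance, selectionInstance, hacts, hgoal, List.map_nil]

section
variable {γ : Type} [DataEnc γ] {F : γ → CNF}

theorem PolyTime.bound (hF : PolyTime F) : PolyTime fun x => (F x).bound :=
  PolyTime.sum (hF.flatten.map (f := fun _ (l : Literal) => l.1) PolyTime.id.snd.fst)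

theorem PolyTime.positions (hF : PolyTime F) : PolyTime fun x => (F x).positions :=
  (hF.flatten.map (f := fun _ (l : Literal) => l.1 + 1) PolyTime.id.snd.fst.succ).append
    (.singleton (hF.bound.add (.const 2)))

theorem PolyTime.gapSat {x y : γ → ℕ} {C : γ → Clause} (hx : PolyTime x) (hy : PolyTime y)
    (hC : PolyTime C) : PolyTime fun q => gapSat (x q) (y q) (C q) := by
  unfold PlanReuse.gapSat
  have hl : PolyTime fun q : γ × Literal => q.2.1 + 1 := PolyTime.id.snd.fst.succ
  exact hC.any (.ite PolyTime.id.snd.snd (hl.decide_eq (hy.comp PolyTime.id.fst))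
    (.and (.decide_lt (hx.comp PolyTime.id.fst) hl) (.decide_lt hl (hy.comp PolyTime.id.fst))))

theorem PolyTime.rawStep {j x y : γ → ℕ} (hF : PolyTime F) (hj : PolyTime j) (hx : PolyTime x)
    (hy : PolyTime y) : PolyTime fun q => rawStep (F q) (j q) (x q) (y q) := by
  unfold PlanReuse.rawStep
  refine .pair (.cons hx.some (.cons hj.some (hF.map (.const none))))
    (.cons hy.some (.cons hj.succ.some (hF.map (.ite ?_ (.const _) (.const none)))))
  exact .gapSat (hx.comp PolyTime.id.fst) (hy.comp PolyTime.id.fst) PolyTime.id.snd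

theorem PolyTime.rawSteps {k : γ → ℕ} (hF : PolyTime F) (hk : PolyTime k) :
    PolyTime fun q => rawSteps (F q) (k q) := by
  unfold PlanReuse.rawSteps
  refine .flatMap hk.succ.range ?_
  refine .flatMap ((hF.bound.comp PolyTime.id.fst).add (.const 3)).range ?_
  refine .map (.filter (hF.positions.comp PolyTime.id.fst.fst) ?_) ?_
  · exact .decide_lt PolyTime.id.fst.snd PolyTime.id.snd
  · exact .rawStep (hF.comp PolyTime.id.fst.fst.fst) PolyTime.id.fst.fst.snd PolyTime.id.fst.snd
      PolyTime.id.snd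

theorem PolyTime.replicate {α : Type} [DataEnc α] {n : γ → ℕ} {a : γ → α} (hn : PolyTime n)
    (ha : PolyTime a) : PolyTime fun q => List.replicate (n q) (a q) :=
  (hn.units.map (f := fun q _ => a q) (ha.comp PolyTime.id.fst)).of_eq fun q => by simp

theorem PolyTime.selectionInstance {k : γ → ℕ} (hF : PolyTime F) (hk : PolyTime k) :
    PolyTime fun q => selectionInstance (F q) (k q) := by
  suffices h : PolyTime fun q => PlanReuse.rawInstance (PlanReuse.selectionInstance (F q) (k q)) from
    h.of_enc_eq fun q => (enc_rawInstance _).symm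
  simp only [rawInstance_selectionInstance]
  have hlen : PolyTime fun q => (F q).length + 2 := hF.length.add (.const 2)
  have hzero : PolyTime fun q => List.replicate ((F q).length + 2) 0 := hlen.replicate (.const 0)
  refine .pair (hlen.replicate ((hF.bound.add hk).add (.const 3))) (.pair hzero (.pair ?_
    (.pair (hF.rawSteps hk) (.pair hzero (.pair (hlen.replicate (.const none)) (.pair (.const [])
      (.pair (hF.rawSteps hk) (.const ()))))))))
  exact .cons (hF.bound.add (.const 2)).some (.cons hk.succ.some (hF.map (.const _)))
end

theorem weightedCNFSat_reducible_lCaseMod : FptReducible weightedCNFSat lCaseMod := by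
  refine FptReducible.of_runs (P := weightedCNFSat) (Q := lCaseMod)
    (fun x => (selectionInstance x.1 x.2, x.2 + 1)) (fun k => k + 1) ?_ Computable.succ
    (fun F k => selectionInstance_solvable_iff.symm) (fun _ _ => le_rfl)
  have hF : PolyTime fun x : CNF × ℕ => x.1 := PolyTime.id.fst
  have hk : PolyTime fun x : CNF × ℕ => x.2 := PolyTime.id.snd
  exact (PolyTime.selectionInstance hF hk).pair hk.succ

end PlanReuse

/-- Case modification, parameterized by the number of glue steps, is W[2]-complete. -/
theorem mainTheorem3 : PlanReuse.W2Complete PlanReuse.lCaseMod :=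
  ⟨PlanReuse.lCaseMod_mem_W2, fun _ h => h.trans PlanReuse.weightedCNFSat_reducible_lCaseMod⟩
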